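/- Let $V$ be a finite set of nodes; all DAGs have node set $V$. A node ordering is a list of all elements of $V$, each occurring exactly once; it is consistent with a DAG if $a$ precedes $b$ in it for every arc $a\to b$. Write $\mathrm{Pa}_G(b)$ for the set of parents of $b$ in $G$. A route in a DAG $G$ is a nonempty sequence of (not necessarily distinct) nodes in which every two consecutive nodes are joined by an arc, in either direction; a single node is a route. For $Z\subseteq V$ a route is $Z$-active if every collider occurrence of a node $c$ in it (an occurrence of the form $a\to c\leftarrow b$, where $a=b$ is allowed) is in $Z$ and every other occurrence of a node in it is outside $Z$. For pairwise disjoint $X,Y,Z\subseteq V$, $X$ is separated from $Y$ given $Z$ in $G$ if no route between a node of $X$ and a node of $Y$ is $Z$-active. $I(G)$ denotes the set of all separation statements, i.e. triples $(X,Y,Z)$, that hold in $G$. A DAG $H$ is a minimal directed independence (MDI) map of $I(G)$ relative to a node ordering $\alpha$ if $I(H)\subseteq I(G)$, this inclusion fails after removing any single arc from $H$, and $H$ is consistent with $\alpha$. To cover an arc $a\to b$ of $G$ is to add to $G$ the smallest set of arcs after which $\mathrm{Pa}(a)=\mathrm{Pa}(b)\setminus\{a\}$; to reverse it is to replace it by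 $b\to a$. "Cover and reverse" does the former and then the latter. Consider the following algorithms. (Corrected) Construct $\beta(G,\alpha)$. Start with the empty ordering $\beta$ and $G'=G$. While $G'$ has a node: let $A$ be the rightmost node in $\alpha$ that is a sink (has no children) in $G'$, and add $A$ as the leftmost node of $\beta$; as long as $A$ has a right neighbor $B$ in $\beta$ with $A\notin \mathrm{Pa}_G(B)$ and $A$ to the right of $B$ in $\alpha$, interchange $A$ and $B$ in $\beta$; then remove $A$ and its incoming arcs from $G'$. Return $\beta$. Method A$(G,\alpha)$. Let $\beta$ be the result of Construct $\beta(G,\alpha)$. While $\beta\neq\alpha$: let $Y$ be the leftmost node in $\beta$ whose left neighbor in $\beta$ is to its right in $\alpha$; as long as $Y$ has a left neighbor $Z$ in $\beta$ that is to the right of $Y$ in $\alpha$, cover and reverse $Z\to Y$ in $G$ if this arc is in $G$, and interchange $Y$ and $Z$ in $\beta$. Return $G$. Method B$(G,\alpha)$. Let $\beta$ be the result of Construct $\beta(G,\alpha)$. While $\beta\neq\alpha$: let $Y$ be the leftmost node in $\beta$ whose right neighbor in $\beta$ is to its left in $\alpha$; as long as $Y$ has a right neighbor $Z$ in $\beta$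 that is to the left of $Y$ in $\alpha$, cover and reverse $Y\to Z$ in $G$ if this arc is in $G$, and interchange $Y$ and $Z$ in $\beta$. Return $G$. **Theorem.** Let $G$ be a DAG with node set $V$ and let $\alpha$ be a node ordering. There is exactly one MDI map $G_\alpha$ of $I(G)$ relative to $\alpha$, and Method A$(G,\alpha)$ and Method B$(G,\alpha)$ both halt and return $G_\alpha$. -/

import Mathlib

namespace ConsensusBN

variable {V : Type*}

/-! ### DAGs, routes and separation -/

/-- A directed graph is a DAG if it has no directed cycle (in particular no loop). -/
def IsDAG (G : Digraph V) : Prop :=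
  ∀ v, ¬ Relation.TransGen G.Adj v v

/-- The parents of `b` in `G`. -/
def parents (G : Digraph V) (b : V) : Set V :=
  {a | G.Adj a b}

/-- Two nodes are adjacent if there is an arc between them, in either direction. -/
def Adjacent (G : Digraph V) (a b : V) : Prop :=
  G.Adj a b ∨ G.Adj b a

/-- `ρ` is a route between `a` and `b`: a sequence of not necessarily distinct nodes that starts
with `a` and ends with `b`, every two consecutive ones being adjacent. The one-node sequence `[a]`
is a route of length zero. -/
def IsRoute (G : Digraph V) (a b : V) (ρ : List V) : Prop :=
  ρ.head? = some a ∧ ρ.getLast? = some b ∧ ρ.IsChain (Adjacent G)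

/-- In the route `p ++ c :: s`, the displayed occurrence of `c` is a collider: the route reads
`a → c ← b` there (`a` and `b` may coincide). -/
def IsCollider (G : Digraph V) (p : List V) (c : V) (s : List V) : Prop :=
  ∃ a b, p.getLast? = some a ∧ s.head? = some b ∧ G.Adj a c ∧ G.Adj b c

/-- `ρ` is `Z`-active: every collider occurrence in `ρ` is in `Z`, every other occurrence of a node
in `ρ` is outside `Z`. -/
def IsActive (G : Digraph V) (Z : Set V) (ρ : List V) : Prop :=
  ∀ p c s, ρ = p ++ c :: s → (IsCollider G p c s ↔ c ∈ Z)

/-- `X` is separated from `Y` given `Z` in `G`. -/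
def Separated (G : Digraph V) (X Y Z : Set V) : Prop :=
  ¬ ∃ a ∈ X, ∃ b ∈ Y, ∃ ρ, IsRoute G a b ρ ∧ IsActive G Z ρ

/-! ### Independence models and minimal directed independence maps -/

/-- An independence model: a set of statements "`X` is independent of `Y` given `Z`", a statement
being the triple `(X, Y, Z)`. -/
abbrev IndepModel (V : Type*) := Set (Set V × Set V × Set V)

/-- The independence model `I(G)` induced by `G`: the separation statements, over pairwise disjoint
sets of nodes, that hold in `G`. -/
def inducedModel (G : Digraph V) : IndepModel V :=
  {t | Disjoint t.1 t.2.1 ∧ Disjoint t.1 t.2.2 ∧ Disjoint t.2.1 t.2.2 ∧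
    Separated G t.1 t.2.1 t.2.2}

/-- `G` without the arc `a → b`. -/
def removeArc (G : Digraph V) (a b : V) : Digraph V where
  Adj x y := G.Adj x y ∧ ¬ (x = a ∧ y = b)

/-- The DAG `H` is a directed independence map of `M`. -/
def IsIMap (M : IndepModel V) (H : Digraph V) : Prop :=
  IsDAG H ∧ inducedModel H ⊆ M

/-- The DAG `H` is a minimal directed independence (MDI) map of `M`. -/
def IsMDIMap (M : IndepModel V) (H : Digraph V) : Prop :=
  IsIMap M H ∧ ∀ a b, H.Adj a b → ¬ IsIMap M (removeArc H a b)

/-- A node ordering: a list in which every node occurs exactly once. -/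
def IsNodeOrdering (α : List V) : Prop :=
  α.Nodup ∧ ∀ v, v ∈ α

/-- `a` is to the left of `b` in `α` (equivalently, `b` is to the right of `a`). -/
def LeftOf [DecidableEq V] (α : List V) (a b : V) : Prop :=
  α.idxOf a < α.idxOf b

instance [DecidableEq V] (α : List V) (a b : V) : Decidable (LeftOf α a b) :=
  inferInstanceAs (Decidable (α.idxOf a < α.idxOf b))

/-- `H` is consistent with the node ordering `α`. -/
def Consistent [DecidableEq V] (H : Digraph V) (α : List V) : Prop :=
  ∀ a b, H.Adj a b → LeftOf α a b

/-- `H` is a MDI map of `M` relative to the node ordering `α`. -/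
def IsMDIMapRel [DecidableEq V] (M : IndepModel V) (α : List V) (H : Digraph V) : Prop :=
  IsMDIMap M H ∧ Consistent H α

/-! ### Covering and reversing an arc -/

/-- The arc `a → b` is in `G` and is covered in `G`. -/
def IsCovered (G : Digraph V) (a b : V) : Prop :=
  G.Adj a b ∧ parents G a = parents G b \ {a}

/-- Cover the arc `a → b`: add `x → b` for every parent `x` of `a`, and `x → a` for every parent
`x ≠ a` of `b`. -/
def cover (G : Digraph V) (a b : V) : Digraph V where
  Adj x y := G.Adj x y ∨ (y = b ∧ G.Adj x a) ∨ (y = a ∧ x ≠ a ∧ G.Adj x b)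

/-- `cover G a b` adds to `G` the smallest set of arcs that makes `a → b` covered. -/
theorem isLeast_cover {G : Digraph V} (hG : IsDAG G) {a b : V} (hab : G.Adj a b) :
    IsLeast {H : Digraph V | G ≤ H ∧ IsCovered H a b} (cover G a b) := by
  have haa : ¬ G.Adj a a := fun h => hG a (.single h)
  have hne : a ≠ b := fun h => haa (h ▸ hab)
  refine ⟨⟨fun x y h => Or.inl h, Or.inl hab, ?_⟩, ?_⟩
  · ext x
    by_cases hx : x = a
    · subst hx
      simp [parents, cover, haa, hne]
    · simp only [parents, cover, Set.mem_ofPred_eq, Set.mem_sdiff, Set.mem_singleton_iff]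
      tauto
  · rintro H ⟨hGH, -, hcov⟩ x y (h | ⟨rfl, h⟩ | ⟨rfl, hx, h⟩)
    · exact hGH h
    · have : x ∈ parents H a := hGH h
      rw [hcov] at this
      exact this.1
    · have : x ∈ parents H b \ {y} := ⟨hGH h, hx⟩
      rw [← hcov] at this
      exact this

/-- Replace the arc `a → b` by `b → a`. -/
def reverseArc (G : Digraph V) (a b : V) : Digraph V where
  Adj x y := (G.Adj x y ∧ ¬ (x = a ∧ y = b)) ∨ (x = b ∧ y = a)

open scoped Classical in
/-- "If `a → b` is in `G` then cover and reverse `a → b` in `G`." -/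
noncomputable def coverReverse (G : Digraph V) (a b : V) : Digraph V :=
  if G.Adj a b then reverseArc (cover G a b) a b else G

/-! ### Operations on node orderings -/

/-- The right neighbor of `y` in the list, if there is one. -/
def rightNeighbor [DecidableEq V] : List V → V → Option V
  | a :: b :: l, y => if a = y then some b else rightNeighbor (b :: l) y
  | _, _ => none

/-- The left neighbor of `y` in the list, if there is one. -/
def leftNeighbor [DecidableEq V] : List V → V → Option V
  | a :: b :: l, y => if b = y then some a else leftNeighbor (b :: l) y
  | _, _ => none

/-- Interchange the nodes `y` and `z` in `β`. -/
def interchange [DecidableEq V] (y z : V) (β : List V) : List V :=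
  β.map (Equiv.swap y z)

/-! ### The corrected algorithm Construct β

Each algorithm is a deterministic machine: a state records the line about to be executed and the
values of the program variables, the step function executes the line, and is `none` on return. -/

/-- States of Construct `β`. The node set `U` stands for `G'`, the subgraph of `G` on `U`. -/
inductive CBState (V : Type*) where
  | line3 (β : List V) (U : Finset V)
  | line5 (β : List V) (U : Finset V) (A : V)
  | line10 (β : List V) (U : Finset V)
  | line11 (β : List V)

open scoped Classical in
/-- The rightmost node in `α` that is a sink node in the subgraph of `G` on `U`. -/
noncomputable def rightmostSink (G : Digraph V) (α : List V) (U : Finset V) : Option V :=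
  α.reverse.find? fun A => decide (A ∈ U ∧ ∀ B ∈ U, ¬ G.Adj A B)

open scoped Classical in
/-- One step of Construct `β`.
Line 3: let `A` be the rightmost node in `α` that is a sink node in `G'` (if `G'` is empty there is
nothing to pick). Line 4: add `A` as the leftmost node in `β`. Lines 5-8: let `B` be the right
neighbor of `A` in `β`; if it exists, `A` is not a parent of `B` in `G`, and `A` is to the right of
`B` in `α`, then interchange `A` and `B` in `β` and go to line 5. Line 9: remove `A` and its
incoming arcs from `G'`. Line 10: if `G'` is not empty then go to line 3. Line 11: return. -/
noncomputable def cbStep [DecidableEq V] (G : Digraph V) (α : List V) :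
    CBState V → Option (CBState V)
  | .line3 β U =>
    match rightmostSink G α U with
    | some A => some (.line5 (A :: β) U A)
    | none => some (.line10 β U)
  | .line5 β U A =>
    match rightNeighbor β A with
    | some B =>
      if ¬ G.Adj A B ∧ LeftOf α B A then some (.line5 (interchange A B β) U A)
      else some (.line10 β (U.erase A))
    | none => some (.line10 β (U.erase A))
  | .line10 β U => if U.Nonempty then some (.line3 β U) else some (.line11 β)
  | .line11 _ => none

/-- The ordering held in a state. -/
def CBState.ordering : CBState V → List V
  | .line3 β _ => β
  | .line5 β _ _ => β
  | .line10 β _ => β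
  | .line11 β => β

/-- The ordering returned by Construct `β` (an undefined value if it does not halt). -/
noncomputable def constructBeta [Fintype V] [DecidableEq V] (G : Digraph V) (α : List V) :
    Part (List V) :=
  (StateTransition.eval (cbStep G α) (.line3 [] Finset.univ)).map CBState.ordering

/-! ### Methods A and B -/

/-- States of Methods A and B: the current line, the current graph `G`, the current ordering `β`,
and, in the inner loop, the node `Y`. -/
inductive MState (V : Type*) where
  | line2 (G : Digraph V) (β : List V)
  | line3 (G : Digraph V) (β : List V) (Y : V)
  | line8 (G : Digraph V) (β : List V)
  | line9 (G : Digraph V)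

/-- The graph held in a state. -/
def MState.graph : MState V → Digraph V
  | .line2 G _ => G
  | .line3 G _ _ => G
  | .line8 G _ => G
  | .line9 G => G

/-- One step of Method A.
Line 2: let `Y` be the leftmost node in `β` whose left neighbor in `β` is to its right in `α` (if
there is none, lines 3-7 are skipped). Line 3: let `Z` be the left neighbor of `Y` in `β`.
Lines 4-7: if `Z` exists and is to the right of `Y` in `α`, then cover and reverse `Z → Y` if it is
in `G`, interchange `Y` and `Z` in `β`, and go to line 3. Line 8: if `β ≠ α` then go to line 2.
Line 9: return `G`. -/
noncomputable def stepA [DecidableEq V] (α : List V) : MState V → Option (MState V)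
  | .line2 G β =>
    match β.find? fun Y => (leftNeighbor β Y).any fun Z => decide (LeftOf α Y Z) with
    | some Y => some (.line3 G β Y)
    | none => some (.line8 G β)
  | .line3 G β Y =>
    match leftNeighbor β Y with
    | some Z =>
      if LeftOf α Y Z then some (.line3 (coverReverse G Z Y) (interchange Y Z β) Y)
      else some (.line8 G β)
    | none => some (.line8 G β)
  | .line8 G β => if β ≠ α then some (.line2 G β) else some (.line9 G)
  | .line9 _ => none

/-- One step of Method B.
Line 2: let `Y` be the leftmost node in `β` whose right neighbor in `β` is to its left in `α` (if
there is none, lines 3-7 are skipped). Line 3: let `Z` be the right neighbor of `Y` in `β`.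
Lines 4-7: if `Z` exists and is to the left of `Y` in `α`, then cover and reverse `Y → Z` if it is
in `G`, interchange `Y` and `Z` in `β`, and go to line 3. Line 8: if `β ≠ α` then go to line 2.
Line 9: return `G`. -/
noncomputable def stepB [DecidableEq V] (α : List V) : MState V → Option (MState V)
  | .line2 G β =>
    match β.find? fun Y => (rightNeighbor β Y).any fun Z => decide (LeftOf α Z Y) with
    | some Y => some (.line3 G β Y)
    | none => some (.line8 G β)
  | .line3 G β Y =>
    match rightNeighbor β Y with
    | some Z =>
      if LeftOf α Z Y then some (.line3 (coverReverse G Y Z) (interchange Y Z β) Y)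
      else some (.line8 G β)
    | none => some (.line8 G β)
  | .line8 G β => if β ≠ α then some (.line2 G β) else some (.line9 G)
  | .line9 _ => none

/-- The graph returned by Method A, an undefined value if it does not halt. -/
noncomputable def methodA [Fintype V] [DecidableEq V] (G : Digraph V) (α : List V) :
    Part (Digraph V) :=
  (constructBeta G α).bind fun β =>
    (StateTransition.eval (stepA α) (.line2 G β)).map MState.graph

/-- The graph returned by Method B, an undefined value if it does not halt. -/
noncomputable def methodB [Fintype V] [DecidableEq V] (G : Digraph V) (α : List V) :
    Part (Digraph V) :=
  (constructBeta G α).bind fun β =>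
    (StateTransition.eval (stepB α) (.line2 G β)).map MState.graph

end ConsensusBN

namespace ConsensusBN

variable {V : Type*}

/-! ### Active routes as reachability -/

/-! Both methods only interchange neighbors `z`, `y` of the current ordering `β` that `α` orders the
other way, covering and reversing `z → y` if it is an arc of the current graph `H`. Two properties
of `H` are kept. Connections of `G` persist (`imap`): adding arcs destroys no connection, and
neither does reversing a covered arc (`Conn.reverseArc`). Every arc `u → v` of `H` is forced
(`needed`): `u` and `v` are connected in `G` given the other predecessors of `v` in `β`. Once `β =
α`, forced arcs lie in every independence map consistent with `α` (`le_of_needed`), so `H` is the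
least such map and hence the only minimal one.

The delicate point is that arcs stay forced (`Invariant.needed_coverReverse`), since an interchange
changes the predecessors of `y` and `z` and covering adds arcs. With `P` the predecessors of `z`, it
rests on two facts about `G`: some descendant of `z` is `y` or lies in `P`, and no descendant of `y`
is `z` or lies in `P`. The first comes from Construct `β`, which always takes the rightmost sink
(`IsGreedy`). The second comes from the order of the interchanges: a node that has passed another
one to the right has only rightly placed nodes to its left (`interchanged`).

Each interchange removes an inversion, and an ordering without inverted neighbors is `α`, so both
methods halt. -/

/-- Some route between `x` and `y` is `Z`-active. -/
def Conn (G : Digraph V) (Z : Set V) (x y : V) : Prop :=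
  ∃ ρ, IsRoute G x y ρ ∧ IsActive G Z ρ

/-- `Reach G Z x v h`: some route from `x` to `v` satisfies the activity condition at all
occurrences but the last one; `h` tells whether its last arc points to `v`. -/
inductive Reach (G : Digraph V) (Z : Set V) (x : V) : V → Bool → Prop
  | start : Reach G Z x x false
  | forward {v w : V} {h : Bool} : Reach G Z x v h → v ∉ Z → G.Adj v w → Reach G Z x w true
  | backward {v w : V} : Reach G Z x v false → v ∉ Z → G.Adj w v → Reach G Z x w false
  | collide {v w : V} : Reach G Z x v true → v ∈ Z → G.Adj w v → Reach G Z x w false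

/-- The arc between the last node of `p` and `v` (if any) points to `v` if `h` holds, and away from
`v` otherwise. -/
def LastArc (G : Digraph V) (p : List V) (v : V) (h : Bool) : Prop :=
  if h then ∃ u, p.getLast? = some u ∧ G.Adj u v else ∀ u, p.getLast? = some u → G.Adj v u

theorem IsDAG.asymm {G : Digraph V} (hG : IsDAG G) {a b : V} (h : G.Adj a b) : ¬ G.Adj b a :=
  fun h' => hG a (.tail (.single h) h')

theorem IsCollider.symm {G : Digraph V} {p s : List V} {c : V} (h : IsCollider G p c s) :
    IsCollider G s.reverse c p.reverse := by
  obtain ⟨a, b, ha, hb, hac, hbc⟩ := h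
  exact ⟨b, a, by simpa using hb, by simpa using ha, hbc, hac⟩

theorem Conn.symm {G : Digraph V} {Z : Set V} {x y : V} (h : Conn G Z x y) : Conn G Z y x := by
  obtain ⟨ρ, ⟨h1, h2, h3⟩, h4⟩ := h
  refine ⟨ρ.reverse, ⟨by simpa using h2, by simpa using h1, ?_⟩, ?_⟩
  · rw [List.isChain_reverse]
    exact h3.imp fun _ _ h => h.symm
  · intro p c s hρ
    have hρ' : ρ = s.reverse ++ c :: p.reverse := by
      have := congrArg List.reverse hρ
      simpa using this
    rw [← h4 _ _ _ hρ']
    refine ⟨fun h => h.symm, fun h => ?_⟩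
    simpa using h.symm

/-- Whether a node is a collider depends only on the arcs beside it, whose directions are
unambiguous in a DAG. So one bit about the last arc is all that has to be remembered. -/
theorem Conn.reach {G : Digraph V} (hG : IsDAG G) {Z : Set V} {x y : V} (h : Conn G Z x y) :
    y ∉ Z ∧ ∃ h, Reach G Z x y h := by
  obtain ⟨ρ, ⟨h1, h2, h3⟩, h4⟩ := h
  have key : ∀ p v s, ρ = p ++ v :: s → ∃ h, Reach G Z x v h ∧ LastArc G p v h := by
    intro p
    induction p using List.reverseRecOn with
    | nil =>
      intro v s hρ
      refine ⟨false, ?_, by simp [LastArc]⟩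
      have : v = x := by simpa [hρ] using h1
      exact this ▸ .start
    | append_singleton p u ih =>
      intro v s hρ
      have hρ' : ρ = p ++ u :: v :: s := by simpa using hρ
      obtain ⟨h, hr, hl⟩ := ih u (v :: s) hρ'
      have hact := h4 _ _ _ hρ'
      have hadj : Adjacent G u v := by
        rw [hρ', List.isChain_append] at h3
        exact (List.isChain_cons_cons.1 h3.2.1).1
      cases h with
      | false =>
        have hu : u ∉ Z := by
          rw [← hact]
          rintro ⟨a, b, ha, -, hau, -⟩
          exact hG.asymm hau (by simpa [LastArc] using (show LastArc G p u false from hl) a ha)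
        rcases hadj with hadj | hadj
        · exact ⟨true, hr.forward hu hadj, u, by simp, hadj⟩
        · exact ⟨false, hr.backward hu hadj, by simpa [LastArc] using hadj⟩
      | true =>
        obtain ⟨a, ha, hau⟩ : ∃ a, p.getLast? = some a ∧ G.Adj a u := by
          simpa [LastArc] using hl
        rcases hadj with hadj | hadj
        · have hu : u ∉ Z := by
            rw [← hact]
            rintro ⟨a, b, -, hb, -, hbu⟩
            obtain rfl : v = b := by simpa using hb
            exact hG.asymm hadj hbu
          exact ⟨true, hr.forward hu hadj, u, by simp, hadj⟩
        · have hu : u ∈ Z := by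
            rw [← hact]
            exact ⟨a, v, ha, by simp, hau, hadj⟩
          exact ⟨false, hr.collide hu hadj, by simpa [LastArc] using hadj⟩
  obtain ⟨p, rfl⟩ : ∃ p, ρ = p ++ [y] := List.getLast?_eq_some_iff.1 h2
  obtain ⟨h, hr, -⟩ := key p y [] rfl
  refine ⟨?_, h, hr⟩
  rw [← h4 p y [] rfl]
  rintro ⟨a, b, -, hb, -⟩
  simp at hb

theorem append_singleton_eq_append_cons {p p₁ s : List V} {v c : V}
    (h : p ++ [v] = p₁ ++ c :: s) :
    (s = [] ∧ c = v ∧ p₁ = p) ∨ ∃ s', s = s' ++ [v] ∧ p = p₁ ++ c :: s' := by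
  induction s using List.reverseRecOn with
  | nil =>
    have := List.append_inj' h rfl
    exact .inl ⟨rfl, by simpa using this.2.symm, this.1.symm⟩
  | append_singleton s w _ =>
    have h' : p ++ [v] = (p₁ ++ c :: s) ++ [w] := by simpa using h
    have := List.append_inj' h' rfl
    obtain rfl : v = w := by simpa using this.2
    exact .inr ⟨s, rfl, this.1⟩

/-- The collider status of a node of `p` is settled by its two neighbors, so only `v` is affected by
what follows it. -/
theorem isActive_extend {G : Digraph V} {Z : Set V} {p t : List V} {v : V}
    (hact : ∀ p₁ c s, p = p₁ ++ c :: s → (IsCollider G p₁ c (s ++ [v]) ↔ c ∈ Z))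
    (hv : IsCollider G p v t ↔ v ∈ Z) {p₁ s : List V} {c : V} (h : p ++ [v] = p₁ ++ c :: s) :
    IsCollider G p₁ c (s ++ t) ↔ c ∈ Z := by
  obtain ⟨rfl, rfl, rfl⟩ | ⟨s', rfl, rfl⟩ := append_singleton_eq_append_cons h
  · simpa using hv
  · rw [← hact p₁ c s' rfl]
    simp [IsCollider]

theorem Reach.exists_list {G : Digraph V} (hG : IsDAG G) {Z : Set V} {x v : V} {h : Bool}
    (hr : Reach G Z x v h) :
    ∃ p : List V, (p ++ [v]).head? = some x ∧ (p ++ [v]).IsChain (Adjacent G) ∧ LastArc G p v h ∧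
      ∀ p₁ c s, p = p₁ ++ c :: s → (IsCollider G p₁ c (s ++ [v]) ↔ c ∈ Z) := by
  have ext : ∀ {p : List V} {v w : V}, (p ++ [v]).IsChain (Adjacent G) → Adjacent G v w →
      (p ++ [v] ++ [w]).IsChain (Adjacent G) := by
    intro p v w h hvw
    rw [List.isChain_append]
    refine ⟨h, by simp, ?_⟩
    simpa using hvw
  induction hr with
  | start => exact ⟨[], by simp, by simp, by simp [LastArc], by simp⟩
  | @forward v w h _ hv hvw ih =>
    obtain ⟨p, h1, h2, h3, h4⟩ := ih
    refine ⟨p ++ [v], by simpa using h1, ext h2 (.inl hvw), ⟨v, by simp, hvw⟩, ?_⟩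
    intro p₁ c s hp
    refine isActive_extend h4 (iff_of_false ?_ hv) hp
    rintro ⟨a, b, -, hb, -, hbv⟩
    obtain rfl : w = b := by simpa using hb
    exact hG.asymm hvw hbv
  | @backward v w _ hv hwv ih =>
    obtain ⟨p, h1, h2, h3, h4⟩ := ih
    refine ⟨p ++ [v], by simpa using h1, ext h2 (.inr hwv), by simpa [LastArc] using hwv, ?_⟩
    intro p₁ c s hp
    refine isActive_extend h4 (iff_of_false ?_ hv) hp
    rintro ⟨a, b, ha, -, hav, -⟩
    have h3' : ∀ u, p.getLast? = some u → G.Adj v u := by simpa [LastArc] using h3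
    exact hG.asymm hav (h3' a ha)
  | @collide v w _ hv hwv ih =>
    obtain ⟨p, h1, h2, h3, h4⟩ := ih
    refine ⟨p ++ [v], by simpa using h1, ext h2 (.inr hwv), by simpa [LastArc] using hwv, ?_⟩
    intro p₁ c s hp
    refine isActive_extend h4 (iff_of_true ?_ hv) hp
    obtain ⟨a, ha, hav⟩ : ∃ a, p.getLast? = some a ∧ G.Adj a v := by simpa [LastArc] using h3
    exact ⟨a, w, ha, by simp, hav, hwv⟩

theorem Reach.conn {G : Digraph V} (hG : IsDAG G) {Z : Set V} {x v : V} {h : Bool}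
    (hr : Reach G Z x v h) (hv : v ∉ Z) : Conn G Z x v := by
  obtain ⟨p, h1, h2, -, h4⟩ := hr.exists_list hG
  refine ⟨p ++ [v], ⟨h1, by simp, h2⟩, fun p₁ c s hp => ?_⟩
  have := isActive_extend (t := []) h4 (iff_of_false ?_ hv) hp
  · simpa using this
  · rintro ⟨a, b, -, hb, -⟩
    simp at hb

/-! ### Adding arcs and reversing covered arcs -/

theorem Reach.mono {G H : Digraph V} (hGH : G ≤ H) {Z : Set V} {x v : V} {h : Bool}
    (hr : Reach G Z x v h) : Reach H Z x v h := by
  induction hr with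
  | start => exact .start
  | forward _ hv hvw ih => exact ih.forward hv (hGH hvw)
  | backward _ hv hvw ih => exact ih.backward hv (hGH hvw)
  | collide _ hv hvw ih => exact ih.collide hv (hGH hvw)

theorem Conn.mono {G H : Digraph V} (hG : IsDAG G) (hH : IsDAG H) (hGH : G ≤ H) {Z : Set V}
    {x y : V} (h : Conn G Z x y) : Conn H Z x y := by
  obtain ⟨hy, k, hr⟩ := h.reach hG
  exact (hr.mono hGH).conn hH hy

/-- What reachability in a graph with the covered arc `a → b` tells about reachability in the graph
with that arc reversed. -/
def ReversedReach (R : V → Bool → Prop) (Z : Set V) (a b v : V) (h : Bool) : Prop :=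
  (v ≠ a → v ≠ b → R v h) ∧
  (v = a → h = true → R a true ∧ R b true) ∧
  (v = a → h = false → R a false ∨ (R a true ∧ R b true ∧ b ∈ Z) ∨ (R b false ∧ b ∉ Z)) ∧
  (v = b → h = true → (R a true ∧ R b true) ∨ (R a false ∧ a ∉ Z) ∨ (R b false ∧ b ∉ Z)) ∧
  (v = b → h = false → R b false)

theorem Reach.reverseArc {G : Digraph V} (hG : IsDAG G) {a b : V} (hcov : IsCovered G a b)
    {Z : Set V} {x v : V} {h : Bool} (hr : Reach G Z x v h) :
    ReversedReach (Reach (reverseArc G a b) Z x) Z a b v h := by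
  have hab := hcov.1
  have hpar : ∀ q, G.Adj q a ↔ G.Adj q b ∧ q ≠ a := fun q => by
    have := Set.ext_iff.1 hcov.2 q
    simpa [parents] using this
  have haa : ¬ G.Adj a a := fun h => hG.asymm h h
  have hbb : ¬ G.Adj b b := fun h => hG.asymm h h
  have hba := hG.asymm hab
  have hne : a ≠ b := fun h => haa (h ▸ hab)
  have arc : ∀ {u w}, G.Adj u w → ¬ (u = a ∧ w = b) → (ConsensusBN.reverseArc G a b).Adj u w :=
    fun h h' => .inl ⟨h, h'⟩
  have arcba : (ConsensusBN.reverseArc G a b).Adj b a := .inr ⟨rfl, rfl⟩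
  have arcs : ∀ {u w}, G.Adj u w → (u = a ∧ w = b) ∨ (ConsensusBN.reverseArc G a b).Adj u w :=
    fun {u w} h => by
      by_cases h' : u = a ∧ w = b
      · exact .inl h'
      · exact .inr (arc h h')
  have fw {v w h} := @Reach.forward V (ConsensusBN.reverseArc G a b) Z x v w h
  have bw {v w} := @Reach.backward V (ConsensusBN.reverseArc G a b) Z x v w
  have co {v w} := @Reach.collide V (ConsensusBN.reverseArc G a b) Z x v w
  have st := @Reach.start V (ConsensusBN.reverseArc G a b) Z x
  -- Only the closure rules collected above matter; forgetting what `R` is leaves a finite case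
  -- check.
  generalize Reach (ConsensusBN.reverseArc G a b) Z x = R at *
  induction hr with
  | start => unfold ReversedReach; grind
  | @forward v w h _ hv hvw ih =>
    unfold ReversedReach at *
    by_cases hva : v = a <;> by_cases hvb : v = b <;> by_cases hwa : w = a <;>
      by_cases hwb : w = b <;> grind
  | @backward v w _ hv hwv ih =>
    unfold ReversedReach at *
    by_cases hva : v = a <;> by_cases hvb : v = b <;> by_cases hwa : w = a <;>
      by_cases hwb : w = b <;> grind
  | @collide v w _ hv hwv ih =>
    unfold ReversedReach at *
    by_cases hva : v = a <;> by_cases hvb : v = b <;> by_cases hwa : w = a <;>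
      by_cases hwb : w = b <;> grind

theorem ReversedReach.exists_of_notMem {R : V → Bool → Prop} {Z : Set V} {a b v : V} {h : Bool}
    (hR : ReversedReach R Z a b v h) (hv : v ∉ Z) (hab : R b false → b ∉ Z → R a true)
    (hba : R a false → a ∉ Z → R b false) : ∃ h, R v h := by
  unfold ReversedReach at hR
  by_cases hva : v = a <;> by_cases hvb : v = b <;> cases h <;> grind

/-- The other parents of `a` and `b` coincide, so an arrow into one of them can be diverted into the
other. Where `ReversedReach` offers only the opposite endpoint, one step along the new arc `b → a`
completes the route. -/
theorem Conn.reverseArc {G : Digraph V} (hG : IsDAG G) {a b : V} (hcov : IsCovered G a b)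
    (hG' : IsDAG (reverseArc G a b)) {Z : Set V} {x y : V} (h : Conn G Z x y) :
    Conn (reverseArc G a b) Z x y := by
  obtain ⟨hy, k, hr⟩ := h.reach hG
  have arcba : (ConsensusBN.reverseArc G a b).Adj b a := .inr ⟨rfl, rfl⟩
  obtain ⟨h, hr'⟩ := (hr.reverseArc hG hcov).exists_of_notMem hy
    (fun h hb => h.forward hb arcba) (fun h ha => h.backward ha arcba)
  exact hr'.conn hG' hy

theorem Conn.coverReverse {G : Digraph V} (hG : IsDAG G) {a b : V}
    (hC : G.Adj a b → IsDAG (cover G a b)) (hR : IsDAG (coverReverse G a b)) {Z : Set V} {x y : V}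
    (h : Conn G Z x y) : Conn (coverReverse G a b) Z x y := by
  unfold ConsensusBN.coverReverse at *
  split_ifs at * with hab
  · exact (h.mono hG (hC hab) (isLeast_cover hG hab).1.1).reverseArc (hC hab)
      (isLeast_cover hG hab).1.2 hR
  · exact h

/-! ### Changing the conditioning set -/

open Relation StateTransition

/-- A node left against an arrow is an ancestor of the start or of the conditioning set. -/
theorem Reach.ancestor_of_false {G : Digraph V} {W : Set V} {x v : V} (hr : Reach G W x v false) :
    ∃ d, ReflTransGen G.Adj v d ∧ (d = x ∨ d ∈ W) := by
  generalize hh : false = h at hr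
  induction hr with
  | start => exact ⟨x, .refl, .inl rfl⟩
  | forward => simp at hh
  | backward _ _ hwv ih =>
    obtain ⟨d, hd, h⟩ := ih hh
    exact ⟨d, .head hwv hd, h⟩
  | collide _ hv hwv _ => exact ⟨_, .single hwv, .inr hv⟩

/-- Conditioning on a node that is no ancestor of the start or of the conditioning set only affects
its descendants. -/
theorem Reach.insert_of_not_ancestor {G : Digraph V} {W : Set V} {x y v : V} {h : Bool}
    (hy : ∀ d, ReflTransGen G.Adj y d → ¬ (d = x ∨ d ∈ W)) (hr : Reach G W x v h) :
    Reach G (insert y W) x v h ∨ (h = true ∧ TransGen G.Adj y v) := by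
  induction hr with
  | start => exact .inl .start
  | @forward v w h hr hv hvw ih =>
    obtain ih | ⟨-, ih⟩ := ih
    · by_cases hvy : v = y
      · exact .inr ⟨rfl, .single (hvy ▸ hvw)⟩
      · exact .inl (ih.forward (by simp [hvy, hv]) hvw)
    · exact .inr ⟨rfl, ih.tail hvw⟩
  | @backward v w hr hv hwv ih =>
    obtain ih | ⟨ih, -⟩ := ih
    · refine .inl (ih.backward ?_ hwv)
      obtain ⟨d, hd, hd'⟩ := hr.ancestor_of_false
      have hvy : v ≠ y := by
        rintro rfl
        exact hy d hd hd'
      simp [hvy, hv]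
    · simp at ih
  | @collide v w hr hv hwv ih =>
    obtain ih | ⟨-, ih⟩ := ih
    · exact .inl (ih.collide (.inr hv) hwv)
    · exact absurd (.inr hv) (hy v ih.to_reflTransGen)

/-- An active route passes a collider that is an ancestor of the conditioning set, of its start, or
of a node `y`, unless `y` can be reached. -/
theorem Reach.detour {G : Digraph V} {W : Set V} {x y z d : V} (hx : x ∉ W)
    (hd : ReflTransGen G.Adj z d) (hdW : d = x ∨ d = y ∨ d ∈ W) (hr : Reach G W x z true) :
    z ∈ W ∨ Reach G W x z false ∨ ∃ h, Reach G W x y h := by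
  induction hd using ReflTransGen.head_induction_on with
  | refl =>
    obtain rfl | rfl | h := hdW
    -- When the directed path ends at `x`, the old route is dropped and the path is climbed from
    -- `x`.
    · exact .inr (.inl .start)
    · exact .inr (.inr ⟨_, hr⟩)
    · exact .inl h
  | @head a c hac _ ih =>
    by_cases ha : a ∈ W
    · exact .inl ha
    -- Descend to `c` and come back to `a` against the arrow: either `c` is a collider in `W`, or
    -- the route turns further down and passes `c` on its way up.
    have hc := hr.forward ha hac
    obtain h | h | h := ih hc
    · exact .inr (.inl (hc.collide h hac))
    · by_cases hcW : c ∈ W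
      · exact .inr (.inl (hc.collide hcW hac))
      · exact .inr (.inl (h.backward hcW hac))
    · exact .inr (.inr h)

theorem Reach.of_insert_of_ancestor {G : Digraph V} {W : Set V} {x y z v d : V} {h : Bool}
    (hx : x ∉ W) (hz : z ∉ W) (hd : ReflTransGen G.Adj z d) (hdW : d = x ∨ d = y ∨ d ∈ W)
    (hr : Reach G (insert z W) x v h) : Reach G W x v h ∨ ∃ h, Reach G W x y h := by
  induction hr with
  | start => exact .inl .start
  | forward _ hv hvw ih =>
    exact ih.imp_left fun ih => ih.forward (fun h => hv (.inr h)) hvw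
  | backward _ hv hwv ih =>
    exact ih.imp_left fun ih => ih.backward (fun h => hv (.inr h)) hwv
  | collide _ hv hwv ih =>
    obtain ih | ih := ih
    · obtain rfl | hv := hv
      · obtain h | h | h := Reach.detour hx hd hdW ih
        · exact absurd h hz
        · exact .inl (h.backward hz hwv)
        · exact .inr h
      · exact .inl (ih.collide hv hwv)
    · exact .inr ih

theorem Reach.of_insert {G : Digraph V} {W : Set V} {x z v : V} {h : Bool}
    (hr : Reach G (insert z W) x v h) : Reach G W x v h ∨ ∃ h, Reach G W x z h := by
  induction hr with
  | start => exact .inl .start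
  | forward _ hv hvw ih =>
    exact ih.imp_left fun ih => ih.forward (fun h => hv (.inr h)) hvw
  | backward _ hv hwv ih =>
    exact ih.imp_left fun ih => ih.backward (fun h => hv (.inr h)) hwv
  | collide _ hv hwv ih =>
    obtain ih | ih := ih
    · obtain rfl | hv := hv
      · exact .inr ⟨_, ih⟩
      · exact .inl (ih.collide hv hwv)
    · exact .inr ih

/-- Continuing a route at a node left against an arrow. -/
theorem Reach.trans {G : Digraph V} {W : Set V} {x z v : V} {h : Bool} (hx : x ∉ W)
    (hz : Reach G W x z false) (hr : Reach G (insert x W) z v h) : Reach G W x v h := by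
  induction hr with
  | start => exact hz
  | forward _ hv hvw ih => exact ih.forward (fun h => hv (.inr h)) hvw
  | backward _ hv hwv ih => exact ih.backward (fun h => hv (.inr h)) hwv
  | collide _ hv hwv ih =>
    obtain rfl | hv := hv
    -- A collider at `x` is no longer allowed, but the route can restart there.
    · exact Reach.start.backward hx hwv
    · exact ih.collide hv hwv

/-- Continuing a route at a collider `y` that becomes part of the conditioning set. -/
theorem Reach.trans_collider {G : Digraph V} {W : Set V} {x y v : V} {h : Bool} (hx : x ∉ W)
    (hxy : x ≠ y) (hy : ∀ d, ReflTransGen G.Adj y d → ¬ (d = x ∨ d ∈ W))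
    (hxy' : Reach G (insert y W) x y true) (hr : Reach G (insert x W) y v h) :
    (v = y ∧ h = false) ∨ Reach G (insert y W) x v h ∨ (h = true ∧ TransGen G.Adj y v) := by
  induction hr with
  | start => exact .inl ⟨rfl, rfl⟩
  | @forward v w h _ hv hvw ih =>
    right
    by_cases hvy : v = y
    · exact .inr ⟨rfl, .single (hvy ▸ hvw)⟩
    obtain ⟨rfl, -⟩ | ih | ⟨-, ih⟩ := ih
    · exact absurd rfl hvy
    · exact .inl (ih.forward (by simp [hvy]; exact fun h => hv (.inr h)) hvw)
    · exact .inr ⟨rfl, ih.tail hvw⟩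
  | @backward v w _ hv hwv ih =>
    by_cases hvy : v = y
    · subst hvy
      -- However `y` was reached, enter it from `x` by an arrow instead: it is then a collider in
      -- the new conditioning set.
      exact .inr (.inl (hxy'.collide (.inl rfl) hwv))
    obtain ⟨rfl, -⟩ | ih | ⟨ih, -⟩ := ih
    · exact absurd rfl hvy
    · exact .inr (.inl (ih.backward (by simp [hvy]; exact fun h => hv (.inr h)) hwv))
    · simp at ih
  | @collide v w _ hv hwv ih =>
    obtain ⟨-, ih⟩ | ih | ⟨-, ih⟩ := ih
    · simp at ih
    · obtain rfl | hv := hv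
      · exact .inr (.inl (Reach.start.backward (by simp [hxy, hx]) hwv))
      · exact .inr (.inl (ih.collide (.inr hv) hwv))
    · obtain rfl | hv := hv
      · exact absurd (.inl rfl) (hy _ ih.to_reflTransGen)
      · exact absurd (.inr hv) (hy _ ih.to_reflTransGen)

/-- A non-collider occurrence of `y` makes `y` an ancestor of an endpoint or of a collider in `W`.
As both are excluded, the route survives. -/
theorem Conn.insert_of_not_ancestor {G : Digraph V} (hG : IsDAG G) {W : Set V} {x y z : V}
    (hy : ∀ d, ReflTransGen G.Adj y d → ¬ (d = x ∨ d = z ∨ d ∈ W)) (h : Conn G W x z) :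
    Conn G (insert y W) x z := by
  obtain ⟨hz, k, hr⟩ := h.reach hG
  have hzy : z ≠ y := fun h => hy y .refl (.inr (.inl h.symm))
  obtain h | ⟨-, h⟩ := hr.insert_of_not_ancestor (y := y) fun d hd hd' => hy d hd (by tauto)
  · exact h.conn hG (by simp [hzy, hz])
  · exact absurd (.inr (.inl rfl)) (hy z h.to_reflTransGen)

/-- A collider at `z` is replaced by a detour down to `d` and back up, or by a route that starts at
`x` or ends at `y` when `d` is that node. -/
theorem Conn.of_insert_of_ancestor {G : Digraph V} (hG : IsDAG G) {W : Set V} {x y z d : V}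
    (hx : x ∉ W) (hz : z ∉ W) (hd : ReflTransGen G.Adj z d) (hdW : d = x ∨ d = y ∨ d ∈ W)
    (h : Conn G (insert z W) x y) : Conn G W x y := by
  obtain ⟨hy, k, hr⟩ := h.reach hG
  have hy' : y ∉ W := fun h => hy (.inr h)
  obtain h | ⟨_, h⟩ := hr.of_insert_of_ancestor hx hz hd hdW
  · exact h.conn hG hy'
  · exact h.conn hG hy'

/-- Join the routes at `z`. If the first arrives by an arrow, the detour through `d` lets it arrive
against one, after which it may continue either way, unless it meets `y` already. -/
theorem Conn.trans_of_ancestor {G : Digraph V} (hG : IsDAG G) {W : Set V} {x y z d : V}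
    (hx : x ∉ W) (hd : ReflTransGen G.Adj z d) (hdW : d = x ∨ d = y ∨ d ∈ W)
    (hxz : Conn G W x z) (hzy : Conn G (insert x W) z y) : Conn G W x y := by
  obtain ⟨hz, k, hr⟩ := hxz.reach hG
  obtain ⟨hy, k', hr'⟩ := hzy.reach hG
  have hy' : y ∉ W := fun h => hy (.inr h)
  have key : Reach G W x z false → Conn G W x y := fun h => (h.trans hx hr').conn hG hy'
  cases k with
  | false => exact key hr
  | true =>
    obtain h | h | ⟨_, h⟩ := Reach.detour hx hd hdW hr
    · exact absurd h hz
    · exact key h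
    · exact h.conn hG hy'

/-- Join the routes at `y` as a collider. The first must arrive by an arrow, since otherwise `y`
would be an ancestor of `x`, `z` or `W`; leaving `y` along an arrow would trap the second among
descendants of `y`. Colliders at `z` or `x` are avoided by stopping at `z` or restarting at `x`. -/
theorem Conn.trans_collider {G : Digraph V} (hG : IsDAG G) {W : Set V} {x y z : V}
    (hx : x ∉ W) (hz : z ∉ W)
    (hy : ∀ d, ReflTransGen G.Adj y d → ¬ (d = x ∨ d = z ∨ d ∈ W))
    (hxy : Conn G (insert z W) x y) (hyz : Conn G (insert x W) y z) :
    Conn G (insert y W) x z := by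
  have hzy : z ≠ y := fun h => hy y .refl (.inr (.inl h.symm))
  have hz' : z ∉ insert y W := by simp [hzy, hz]
  obtain ⟨-, k, hr⟩ := hxy.reach hG
  obtain ⟨-, k', hr'⟩ := hyz.reach hG
  obtain h | ⟨-, h⟩ := hr.insert_of_not_ancestor (y := y) (by
    rintro d hd (h | h | h)
    exacts [hy d hd (.inl h), hy d hd (.inr (.inl h)), hy d hd (.inr (.inr h))])
  · cases k with
    | false =>
      obtain ⟨d, hd, h'⟩ := hr.ancestor_of_false
      exact absurd (by simpa using h') (hy d hd)
    | true =>
      rw [Set.insert_comm] at h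
      obtain h | ⟨_, h⟩ := h.of_insert
      · obtain ⟨h, -⟩ | h | ⟨-, h⟩ := Reach.trans_collider hx
          (fun h => hy y .refl (.inl h.symm)) (fun d hd hd' => hy d hd (by tauto)) h hr'
        · exact absurd h hzy
        · exact h.conn hG hz'
        · exact absurd (.inr (.inl rfl)) (hy z h.to_reflTransGen)
      · exact h.conn hG hz'
  · exact absurd h (hG y)

theorem coverReverse_adj {H : Digraph V} {z y u v : V} (h : (coverReverse H z y).Adj u v) :
    (H.Adj u v ∧ ¬ (u = z ∧ v = y)) ∨ (H.Adj z y ∧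
      ((u = y ∧ v = z) ∨ (v = y ∧ u ≠ z ∧ H.Adj u z) ∨ (v = z ∧ u ≠ z ∧ H.Adj u y))) := by
  unfold coverReverse at h
  split_ifs at h with hzy
  · obtain ⟨h, h'⟩ | h := h
    · obtain h | h | h := h
      · exact .inl ⟨h, h'⟩
      · exact .inr ⟨hzy, .inr (.inl ⟨h.1, fun hu => h' ⟨hu, h.1⟩, h.2⟩)⟩
      · exact .inr ⟨hzy, .inr (.inr h)⟩
    · exact .inr ⟨hzy, .inl h⟩
  · exact .inl ⟨h, fun h' => hzy (h'.1 ▸ h'.2 ▸ h)⟩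

/-! ### Node orderings -/

section Orderings

variable [DecidableEq V]

/-- The nodes to the left of `v` in `β`. -/
def preds (β : List V) (v : V) : Set V :=
  {u | LeftOf β u v}

theorem LeftOf.trans {β : List V} {u v w : V} (h : LeftOf β u v) (h' : LeftOf β v w) :
    LeftOf β u w :=
  Nat.lt_trans h h'

theorem LeftOf.irrefl {β : List V} {u : V} : ¬ LeftOf β u u :=
  Nat.lt_irrefl _

theorem LeftOf.asymm {β : List V} {u v : V} (h : LeftOf β u v) : ¬ LeftOf β v u :=
  Nat.lt_asymm h

theorem LeftOf.ne {β : List V} {u v : V} (h : LeftOf β u v) : u ≠ v := by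
  rintro rfl
  exact h.irrefl

theorem IsNodeOrdering.idxOf_inj {β : List V} (hβ : IsNodeOrdering β) {u v : V} :
    β.idxOf u = β.idxOf v ↔ u = v :=
  List.idxOf_inj (hβ.2 u)

theorem IsNodeOrdering.total {β : List V} (hβ : IsNodeOrdering β) {u v : V} (huv : u ≠ v) :
    LeftOf β u v ∨ LeftOf β v u :=
  Nat.lt_or_gt_of_ne fun h => huv (hβ.idxOf_inj.1 h)

theorem Consistent.of_transGen {G : Digraph V} {β : List V} (h : Consistent G β) {u v : V}
    (huv : TransGen G.Adj u v) : LeftOf β u v := by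
  induction huv with
  | single h' => exact h _ _ h'
  | tail _ h' ih => exact ih.trans (h _ _ h')

theorem Consistent.isDAG {G : Digraph V} {β : List V} (h : Consistent G β) : IsDAG G :=
  fun _ hv => (h.of_transGen hv).irrefl

theorem idxOf_map_of_injective {f : V → V} (hf : Function.Injective f) (l : List V) (v : V) :
    (l.map f).idxOf (f v) = l.idxOf v := by
  induction l with
  | nil => rfl
  | cons a l ih => by_cases h : a = v <;> simp [hf.eq_iff, h, ih]

theorem idxOf_interchange (β : List V) (y z v : V) :
    (interchange y z β).idxOf v = β.idxOf (Equiv.swap y z v) := by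
  simpa [interchange] using idxOf_map_of_injective (Equiv.swap y z).injective β (Equiv.swap y z v)

theorem IsNodeOrdering.interchange {β : List V} (hβ : IsNodeOrdering β) (y z : V) :
    IsNodeOrdering (interchange y z β) := by
  refine ⟨hβ.1.map (Equiv.swap y z).injective, fun v => ?_⟩
  exact List.mem_map.2 ⟨Equiv.swap y z v, hβ.2 _, by simp⟩

theorem leftOf_interchange {β : List V} (hβ : IsNodeOrdering β) {y z : V}
    (hadj : β.idxOf y = β.idxOf z + 1) {u v : V} :
    LeftOf (interchange y z β) u v ↔
      (LeftOf β u v ∧ ¬ (u = z ∧ v = y)) ∨ (u = y ∧ v = z) := by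
  have hu := @IsNodeOrdering.idxOf_inj _ _ _ hβ u
  have hv := @IsNodeOrdering.idxOf_inj _ _ _ hβ v
  have hyz : y ≠ z := by
    rintro rfl
    omega
  simp only [LeftOf, idxOf_interchange, Equiv.swap_apply_def]
  have h1 := @hu y
  have h2 := @hu z
  have h3 := @hv y
  have h4 := @hv z
  split_ifs <;> grind

theorem preds_eq_insert {β : List V} (hβ : IsNodeOrdering β) {y z : V}
    (hadj : β.idxOf y = β.idxOf z + 1) : preds β y = insert z (preds β z) := by
  ext u
  have := @IsNodeOrdering.idxOf_inj _ _ _ hβ u z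
  simp only [preds, LeftOf, Set.mem_ofPred_eq, Set.mem_insert_iff, ← this]
  omega

theorem preds_interchange {β : List V} (hβ : IsNodeOrdering β) {y z v : V}
    (hadj : β.idxOf y = β.idxOf z + 1) :
    preds (interchange y z β) v =
      if v = y then preds β z else if v = z then insert y (preds β z) else preds β v := by
  have h := preds_eq_insert hβ hadj
  ext u
  have h' := Set.ext_iff.1 h u
  have hyz : y ≠ z := by
    rintro rfl
    omega
  have hz : ¬ LeftOf β z z := LeftOf.irrefl
  simp only [preds, leftOf_interchange hβ hadj, Set.mem_insert_iff, Set.mem_ofPred_eq] at h' ⊢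
  split_ifs with h1 h2
  · subst h1
    simp only [Set.mem_ofPred_eq]
    grind
  · subst h2
    simp only [Set.mem_insert_iff, Set.mem_ofPred_eq]
    grind
  · simp only [Set.mem_ofPred_eq]
    grind

/-! ### One interchange -/

theorem Consistent.cover {H : Digraph V} {β : List V} (hβ : IsNodeOrdering β) {y z : V}
    (hadj : β.idxOf y = β.idxOf z + 1) (hH : Consistent H β) : Consistent (cover H z y) β := by
  have hzy : LeftOf β z y := by
    unfold LeftOf
    omega
  rintro u v (h | ⟨rfl, h⟩ | ⟨rfl, hu, h⟩)
  · exact hH _ _ h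
  · exact (hH _ _ h).trans hzy
  · have h1 : u ∈ preds β y := hH _ _ h
    rw [preds_eq_insert hβ hadj] at h1
    exact h1.resolve_left hu

theorem Consistent.coverReverse {H : Digraph V} {β : List V} (hβ : IsNodeOrdering β) {y z : V}
    (hadj : β.idxOf y = β.idxOf z + 1) (hH : Consistent H β) :
    Consistent (coverReverse H z y) (interchange y z β) := by
  intro u v h
  rw [leftOf_interchange hβ hadj]
  unfold ConsensusBN.coverReverse at h
  split_ifs at h with hzy
  · exact h.imp_left fun h => ⟨hH.cover hβ hadj _ _ h.1, h.2⟩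
  · exact .inl ⟨hH _ _ h, fun h' => hzy (h'.1 ▸ h'.2 ▸ h)⟩

/-- What holds of the ordering `β` returned by Construct `β`: if `z` is to the left of `y` in `β`
and to its right in `α` then some descendant of `z` is not to the right of `y` in either. -/
def IsGreedy (G : Digraph V) (α β : List V) : Prop :=
  ∀ y z, LeftOf β z y → LeftOf α y z →
    ∃ d, ReflTransGen G.Adj z d ∧ ¬ LeftOf α y d ∧ ¬ LeftOf β y d

/-- The invariant of Methods A and B, started from `G` and `β₀`, for the current graph `H` and the
current ordering `β`. -/
structure Invariant (G : Digraph V) (α β₀ : List V) (H : Digraph V) (β : List V) : Prop where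
  ordering : IsNodeOrdering β
  consistent : Consistent H β
  imap : ∀ W x y, Conn G W x y → Conn H W x y
  needed : ∀ u v, H.Adj u v → Conn G (preds β v \ {u}) u v
  leftOf : ∀ u v, LeftOf β₀ u v → LeftOf α u v → LeftOf β u v
  interchanged : ∀ u v, LeftOf β₀ v u → LeftOf β u v → ∀ w, LeftOf β w v → LeftOf α w v

theorem Invariant.init {G : Digraph V} {α β : List V} (hβ : IsNodeOrdering β)
    (hG : Consistent G β) : Invariant G α β G β where
  ordering := hβ
  consistent := hG
  imap _ _ _ h := h
  needed u v h := Reach.conn hG.isDAG (Reach.start.forward (by simp) h)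
    fun h => LeftOf.irrefl h.1
  leftOf _ _ h _ := h
  interchanged _ _ h h' := absurd h' h.asymm

/-- An old arc into `y` loses `z` from its conditioning set, and one into `z` gains `y`. An arc
added into `y` joins two connections at `z`; one added into `z` joins two at the collider `y`. Each
case is one of the rules for changing the conditioning set. -/
theorem Invariant.needed_coverReverse {G : Digraph V} {α β₀ : List V} {H : Digraph V} {β : List V}
    (hG : Consistent G β₀) (hα : IsNodeOrdering α) (hβ₀ : IsNodeOrdering β₀)
    (hgr : IsGreedy G α β₀) (hI : Invariant G α β₀ H β) {y z : V}
    (hadj : β.idxOf y = β.idxOf z + 1) (hyz : LeftOf α y z) {u v : V}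
    (harc : (coverReverse H z y).Adj u v) :
    Conn G (preds (interchange y z β) v \ {u}) u v := by
  have hβ := hI.ordering
  have hDAG := hG.isDAG
  have hne := hyz.ne
  have hzy : LeftOf β z y := by
    unfold LeftOf
    omega
  have hzy₀ : LeftOf β₀ z y := by
    by_contra h
    have h := (hβ₀.total hne).resolve_right h
    exact hzy.asymm (hI.leftOf _ _ h hyz)
  have hpy := preds_eq_insert hβ hadj
  have hyP : y ∉ preds β z := fun h => hzy.asymm h
  have hzP : z ∉ preds β z := LeftOf.irrefl
  -- The descendant given by `IsGreedy` is `y` or left of `y` in both `α` and `β₀`; in the latter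
  -- case it is still left of `y` in `β`.
  have hanc : ∃ d, ReflTransGen G.Adj z d ∧ (d = y ∨ d ∈ preds β z) := by
    obtain ⟨d, hd, h1, h2⟩ := hgr y z hzy₀ hyz
    refine ⟨d, hd, ?_⟩
    by_cases hdy : d = y
    · exact .inl hdy
    have h1 := (hα.total hdy).resolve_right h1
    have h2 := (hβ₀.total hdy).resolve_right h2
    have h3 : d ∈ preds β y := hI.leftOf _ _ h2 h1
    rw [hpy] at h3
    obtain rfl | h3 := h3
    · exact absurd h1 hyz.asymm
    · exact .inr h3
  -- Such a descendant was right of `y` in `β₀`, so `y` has been moved past it. Then everything left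
  -- of `y` in `β`, including `z`, would be left of `y` in `α`.
  have hnonanc : ∀ d, ReflTransGen G.Adj y d → ¬ (d = z ∨ d ∈ preds β z) := by
    intro d hd hd'
    have h1 : d ∈ preds β y := by
      rw [hpy]
      exact hd'
    have h2 : LeftOf β₀ y d := by
      obtain rfl | h := reflTransGen_iff_eq_or_transGen.1 hd
      · exact absurd h1 LeftOf.irrefl
      · exact hG.of_transGen h
    exact hyz.asymm (hI.interchanged _ _ h2 h1 z hzy)
  generalize hP : preds β z = P at *
  have hnonanc' : ∀ x, ∀ d, ReflTransGen G.Adj y d → x ∈ P → ¬ (d = x ∨ d = z ∨ d ∈ P \ {x}) := by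
    rintro x d hd hx (rfl | h | h)
    · exact hnonanc _ hd (.inr hx)
    · exact hnonanc _ hd (.inl h)
    · exact hnonanc _ hd (.inr h.1)
  obtain ⟨d, hd, hd'⟩ := hanc
  have hanc' : ∀ x, d = x ∨ d = y ∨ d ∈ P \ {x} := by
    intro x
    by_cases hdx : d = x
    · exact .inl hdx
    · exact .inr (hd'.imp_right fun h => ⟨h, hdx⟩)
  have hins : ∀ {x}, x ∈ P → insert x (P \ {x}) = P := fun hx => Set.insert_sdiff_self_of_mem hx
  have hdiff : ∀ {x w}, x ≠ w → insert w P \ {x} = insert w (P \ {x}) := fun hx =>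
    (Set.insert_sdiff_singleton_comm hx.symm P).symm
  have hzyP : H.Adj z y → Conn G P z y := fun h => by
    have := hI.needed z y h
    rwa [hpy, Set.insert_sdiff_self_of_notMem hzP] at this
  have hPz : ∀ {x}, H.Adj x z → x ∈ P := fun h => hP ▸ hI.consistent _ _ h
  have hPy : ∀ {x}, x ≠ z → H.Adj x y → x ∈ P := fun hx h => by
    have : _ ∈ preds β y := hI.consistent _ _ h
    rw [hpy] at this
    exact this.resolve_left hx
  rw [preds_interchange hβ hadj, hP]
  obtain ⟨huv, hzy'⟩ | ⟨hzy', ⟨rfl, rfl⟩ | ⟨rfl, huz, huv⟩ | ⟨rfl, huz, huv⟩⟩ := coverReverse_adj harc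
  · have h := hI.needed u v huv
    split_ifs with hvy hvz
    · subst hvy
      have huz : u ≠ z := fun h => hzy' ⟨h, rfl⟩
      rw [hpy, hdiff huz] at h
      exact h.of_insert_of_ancestor hDAG (by simp) (fun h => hzP h.1) hd (hanc' u)
    · subst hvz
      have huP := hPz huv
      rw [hP] at h
      rw [hdiff (by rintro rfl; exact hyP huP)]
      exact h.insert_of_not_ancestor hDAG fun d hd => hnonanc' u d hd huP
    · exact h
  · rw [if_neg hne.symm, if_pos rfl, Set.insert_sdiff_self_of_notMem hyP]
    exact (hzyP hzy').symm
  · rw [if_pos rfl]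
    have h := hI.needed u z huv
    rw [hP] at h
    refine h.trans_of_ancestor hDAG (by simp) hd (hanc' u) ?_
    rw [hins (hPz huv)]
    exact hzyP hzy'
  · have huP := hPy huz huv
    rw [if_neg hne.symm, if_pos rfl, hdiff (by rintro rfl; exact hyP huP)]
    have h := hI.needed u y huv
    rw [hpy, hdiff huz] at h
    refine h.trans_collider hDAG (by simp) (fun h => hzP h.1)
      (fun d hd => hnonanc' u d hd huP) ?_
    rw [hins huP]
    exact (hzyP hzy').symm

/-- The node that moves right is `z`, and `hmax` is what `interchanged` has to record about it. -/
theorem Invariant.step {G : Digraph V} {α β₀ : List V} {H : Digraph V} {β : List V}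
    (hG : Consistent G β₀) (hα : IsNodeOrdering α) (hβ₀ : IsNodeOrdering β₀)
    (hgr : IsGreedy G α β₀) (hI : Invariant G α β₀ H β) {y z : V}
    (hadj : β.idxOf y = β.idxOf z + 1) (hyz : LeftOf α y z)
    (hmax : ∀ p, LeftOf β p z → LeftOf α p z) :
    Invariant G α β₀ (coverReverse H z y) (interchange y z β) where
  ordering := hI.ordering.interchange y z
  consistent := hI.consistent.coverReverse hI.ordering hadj
  imap W a b h := (hI.imap W a b h).coverReverse hI.consistent.isDAG
    (fun _ => (hI.consistent.cover hI.ordering hadj).isDAG)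
    (hI.consistent.coverReverse hI.ordering hadj).isDAG
  needed u v h := hI.needed_coverReverse hG hα hβ₀ hgr hadj hyz h
  leftOf u v h h' := by
    rw [leftOf_interchange hI.ordering hadj]
    refine .inl ⟨hI.leftOf u v h h', ?_⟩
    rintro ⟨rfl, rfl⟩
    exact hyz.asymm h'
  interchanged u v h h' w hw := by
    have hzy : LeftOf β z y := by
      unfold LeftOf
      omega
    have hne := hyz.ne
    rw [leftOf_interchange hI.ordering hadj] at h' hw
    obtain ⟨h', huv⟩ | ⟨rfl, rfl⟩ := h'
    · obtain ⟨hw, -⟩ | ⟨rfl, rfl⟩ := hw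
      · exact hI.interchanged u v h h' w hw
      · exact hyz
    · obtain ⟨hw, -⟩ | ⟨rfl, -⟩ := hw
      · exact hmax w hw
      · exact hyz

end Orderings

/-! ### The MDI map relative to a node ordering -/

theorem IsDAG.removeArc {G : Digraph V} (hG : IsDAG G) (a b : V) : IsDAG (removeArc G a b) :=
  fun v h => hG v (TransGen.mono (fun _ _ h => h.1) _ _ h)

theorem inducedModel_subset {G H : Digraph V} (h : ∀ W x y, Conn G W x y → Conn H W x y) :
    inducedModel H ⊆ inducedModel G := by
  rintro t ⟨h1, h2, h3, h4⟩
  refine ⟨h1, h2, h3, ?_⟩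
  rintro ⟨a, ha, b, hb, hab⟩
  exact h4 ⟨a, ha, b, hb, h _ _ _ hab⟩

theorem Conn.of_inducedModel_subset {G H : Digraph V} (h : inducedModel H ⊆ inducedModel G)
    {W : Set V} {a b : V} (hab : a ≠ b) (ha : a ∉ W) (hb : b ∉ W) (hG : Conn G W a b) :
    Conn H W a b := by
  by_contra hH
  have : (({a}, {b}, W) : Set V × Set V × Set V) ∈ inducedModel H := by
    refine ⟨by simpa using hab, by simpa using ha, by simpa using hb, ?_⟩
    rintro ⟨a', rfl, b', rfl, h⟩
    exact hH h
  exact (h this).2.2.2 ⟨a, rfl, b, rfl, hG⟩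

theorem exists_sink {G : Digraph V} (hG : IsDAG G) {U : Finset V} {z : V} (hz : z ∈ U) :
    ∃ d ∈ U, ReflTransGen G.Adj z d ∧ ∀ b ∈ U, ¬ G.Adj d b := by
  have hirr : Std.Irrefl (fun a b : U => TransGen G.Adj b.1 a.1) := ⟨fun a h => hG _ h⟩
  have htr : IsTrans U (fun a b : U => TransGen G.Adj b.1 a.1) := ⟨fun _ _ _ h h' => h'.trans h⟩
  have hwf := Finite.wellFounded_of_trans_of_irrefl (fun a b : U => TransGen G.Adj b.1 a.1)
  obtain ⟨d, hd, hmin⟩ := hwf.has_min {d : U | ReflTransGen G.Adj z d.1} ⟨⟨z, hz⟩, .refl⟩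
  exact ⟨d.1, d.2, hd, fun b hb hdb => hmin ⟨b, hb⟩ (hd.tail hdb) (.single hdb)⟩

theorem exists_rightmostSink {G : Digraph V} (hG : IsDAG G) {α : List V} (hα : IsNodeOrdering α)
    {U : Finset V} (hU : U.Nonempty) : ∃ A, rightmostSink G α U = some A := by
  obtain ⟨z, hz⟩ := hU
  obtain ⟨d, hd, -, hd'⟩ := exists_sink hG hz
  rw [← Option.isSome_iff_exists]
  unfold rightmostSink
  rw [List.find?_isSome]
  exact ⟨d, by simpa using hα.2 d, by simpa using ⟨hd, hd'⟩⟩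

section Orderings

variable [DecidableEq V]

/-- In a graph consistent with `β`, a node is separated from each of its predecessors in `β` which
are not its parents, given the other predecessors. -/
theorem Consistent.adj_of_conn {H : Digraph V} {β : List V} (hH : Consistent H β) {a b : V}
    (hab : LeftOf β a b) (h : Conn H (preds β b \ {a}) a b) : H.Adj a b := by
  by_contra hadj
  obtain ⟨ha, k, hr⟩ := h.symm.reach hH.isDAG
  -- From `b`, a step to a parent meets a conditioned node against an arrow and is stuck. A step to
  -- a child leads ever further right, where no collider is conditioned on.
  have key : ∀ {v k}, Reach H (preds β b \ {a}) b v k →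
      (v = b ∧ k = false) ∨ (k = true ∧ LeftOf β b v) ∨ (k = false ∧ v ∈ preds β b \ {a}) := by
    intro v k hr
    induction hr with
    | start => exact .inl ⟨rfl, rfl⟩
    | forward _ hv hvw ih =>
      obtain ⟨rfl, -⟩ | ⟨-, h⟩ | ⟨-, h⟩ := ih
      · exact .inr (.inl ⟨rfl, hH _ _ hvw⟩)
      · exact .inr (.inl ⟨rfl, h.trans (hH _ _ hvw)⟩)
      · exact absurd h hv
    | backward _ hv hwv ih =>
      obtain ⟨rfl, -⟩ | ⟨h, -⟩ | ⟨-, h⟩ := ih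
      · exact .inr (.inr ⟨rfl, hH _ _ hwv, fun h => hadj (h ▸ hwv)⟩)
      · simp at h
      · exact absurd h hv
    | collide _ hv _ ih =>
      obtain ⟨-, h⟩ | ⟨-, h⟩ | ⟨h, -⟩ := ih
      · simp at h
      · exact absurd hv.1 h.asymm
      · simp at h
  obtain ⟨rfl, -⟩ | ⟨-, h⟩ | ⟨-, h⟩ := key hr
  · exact hab.irrefl
  · exact hab.asymm h
  · exact h.2 rfl

/-- A forced connection of `G` must be present in `H'`, and in a graph consistent with `α` only an
arc connects `u` and `v` given all other predecessors of `v`. -/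
theorem le_of_needed {G H H' : Digraph V} {α : List V} (hH : Consistent H α)
    (hneed : ∀ u v, H.Adj u v → Conn G (preds α v \ {u}) u v)
    (h : inducedModel H' ⊆ inducedModel G) (hH' : Consistent H' α) : H ≤ H' := by
  intro u v huv
  have hlt := hH u v huv
  exact hH'.adj_of_conn hlt ((hneed u v huv).of_inducedModel_subset h hlt.ne (by simp)
    fun h => LeftOf.irrefl h.1)

theorem isMDIMapRel_of_needed {G H : Digraph V} {α : List V} (hH : Consistent H α)
    (himap : ∀ W x y, Conn G W x y → Conn H W x y)
    (hneed : ∀ u v, H.Adj u v → Conn G (preds α v \ {u}) u v) :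
    IsMDIMapRel (inducedModel G) α H := by
  refine ⟨⟨⟨hH.isDAG, inducedModel_subset himap⟩, fun a b hab h => ?_⟩, hH⟩
  exact (le_of_needed hH hneed h.2 (fun u v huv => hH u v huv.1) hab).2 ⟨rfl, rfl⟩

theorem IsMDIMapRel.eq_of_needed {G H H' : Digraph V} {α : List V}
    (hH' : IsMDIMapRel (inducedModel G) α H') (hH : Consistent H α)
    (himap : ∀ W x y, Conn G W x y → Conn H W x y)
    (hneed : ∀ u v, H.Adj u v → Conn G (preds α v \ {u}) u v) : H' = H := by
  have hle := le_of_needed hH hneed hH'.1.1.2 hH'.2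
  ext a b
  refine ⟨fun hab => ?_, fun hab => hle hab⟩
  by_contra hab'
  -- Without an arc that is not in `H`, `H'` still contains `H`, so it is still an independence map.
  refine hH'.1.2 a b hab ⟨hH'.1.1.1.removeArc a b, ?_⟩
  refine inducedModel_subset fun W x y h => (himap W x y h).mono hH.isDAG
    (hH'.1.1.1.removeArc a b) fun u v huv => ⟨hle huv, ?_⟩
  rintro ⟨rfl, rfl⟩
  exact hab' huv

theorem Invariant.isMDIMapRel {G H : Digraph V} {α β₀ : List V} (hI : Invariant G α β₀ H α) :
    IsMDIMapRel (inducedModel G) α H :=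
  isMDIMapRel_of_needed hI.consistent hI.imap hI.needed

theorem Invariant.eq_of_isMDIMapRel {G H H' : Digraph V} {α β₀ : List V}
    (hI : Invariant G α β₀ H α) (hH' : IsMDIMapRel (inducedModel G) α H') : H' = H :=
  hH'.eq_of_needed hI.consistent hI.imap hI.needed

/-! ### Construct `β` -/

theorem rightmostSink_eq_some {G : Digraph V} {α : List V} (hα : IsNodeOrdering α) {U : Finset V}
    {A : V} (h : rightmostSink G α U = some A) :
    (A ∈ U ∧ ∀ b ∈ U, ¬ G.Adj A b) ∧
      ∀ d ∈ U, (∀ b ∈ U, ¬ G.Adj d b) → ¬ LeftOf α A d := by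
  obtain ⟨h1, as, bs, h2, h3⟩ := List.find?_eq_some_iff_append.1 h
  refine ⟨by simpa using h1, fun d hd hd' hlt => ?_⟩
  have h2' : α = bs.reverse ++ A :: as.reverse := by
    have := congrArg List.reverse h2
    simpa using this
  have hdas : d ∉ as := fun hdas => by
    have := h3 d hdas
    simp only [Bool.not_eq_true', decide_eq_false_iff_not] at this
    exact this ⟨hd, hd'⟩
  have hdα := hα.2 d
  have hnd := hα.1
  have hAbs : A ∉ bs := by
    rw [h2', List.nodup_append] at hnd
    intro h
    exact hnd.2.2 A (by simpa using h) A (by simp) rfl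
  unfold LeftOf at hlt
  rw [h2', List.idxOf_append_of_notMem (by simpa using hAbs)] at hlt
  rw [h2'] at hdα
  by_cases hdbs : d ∈ bs
  · rw [List.idxOf_append_of_mem (by simpa using hdbs)] at hlt
    have : bs.reverse.idxOf d < bs.reverse.length := List.idxOf_lt_length_iff.2 (by simpa using hdbs)
    simp at hlt this
    omega
  · have : d = A := by simpa [hdas, hdbs] using hdα
    subst this
    rw [List.idxOf_append_of_notMem (by simpa using hAbs)] at hlt
    exact lt_irrefl _ hlt

/-- The invariant of Construct `β`. -/
structure CBInvariant (G : Digraph V) (α β : List V) (U : Finset V) : Prop where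
  nodup : β.Nodup
  mem : ∀ v, v ∈ β ↔ v ∉ U
  consistent : ∀ a b, a ∈ β → G.Adj a b → b ∈ β ∧ LeftOf β a b
  greedy : ∀ y z, y ∈ β → (z ∈ U ∨ LeftOf β z y) → LeftOf α y z →
    ∃ d, ReflTransGen G.Adj z d ∧ ¬ LeftOf α y d ∧ (d ∈ U ∨ ¬ LeftOf β y d)
  head : ∀ B, β.head? = some B → ∀ A ∈ U, (∀ c ∈ U, ¬ G.Adj A c) → LeftOf α B A → G.Adj A B

/-- No membership is needed: `idxOf` sends an absent node to the length of the list, right of all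
its entries. -/
theorem leftOf_cons {β : List V} {a u v : V} :
    LeftOf (a :: β) u v ↔ v ≠ a ∧ (u = a ∨ LeftOf β u v) := by
  unfold LeftOf
  by_cases hu : a = u <;> by_cases hv : a = v <;> grind

/-- For `greedy`, a remaining `z` has a sink of `G'` among its descendants; it is not right of `A`
in `α`, and it is `A` or will be placed left of `A`. For `head`, a later sink right of `A` in `α`
without an arc to `A` would have been a sink when `A` was chosen, against the choice of `A`. -/
theorem CBInvariant.cons {G : Digraph V} (hG : IsDAG G) {α β : List V} (hα : IsNodeOrdering α)
    {U : Finset V} (hI : CBInvariant G α β U) {A : V} (hA : rightmostSink G α U = some A) :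
    CBInvariant G α (A :: β) (U.erase A) := by
  obtain ⟨⟨hAU, hsink⟩, hmax⟩ := rightmostSink_eq_some hα hA
  have hAβ : A ∉ β := by simpa [hI.mem] using hAU
  have hne : ∀ {b}, b ∈ β → b ≠ A := by
    rintro b hb rfl
    exact hAβ hb
  refine ⟨List.nodup_cons.2 ⟨hAβ, hI.nodup⟩, fun v => ?_, fun a b ha hab => ?_,
    fun y z hy hz hyz => ?_, ?_⟩
  · by_cases hv : v = A <;> simp [hv, hI.mem]
  · have hb : b ∈ β := by
      obtain rfl | ha := List.mem_cons.1 ha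
      · rw [hI.mem]
        exact fun h => hsink b h hab
      · exact (hI.consistent a b ha hab).1
    refine ⟨List.mem_cons_of_mem _ hb, leftOf_cons.2 ⟨hne hb, ?_⟩⟩
    obtain rfl | ha := List.mem_cons.1 ha
    · exact .inl rfl
    · exact .inr (hI.consistent a b ha hab).2
  · obtain rfl | hy := List.mem_cons.1 hy
    · have hzU : z ∈ U := by
        obtain hz | hz := hz
        · exact Finset.mem_of_mem_erase hz
        · exact absurd rfl (leftOf_cons.1 hz).1
      obtain ⟨d, hd, hzd, hd'⟩ := exists_sink hG hzU
      refine ⟨d, hzd, hmax d hd hd', ?_⟩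
      by_cases hdy : d = y
      · exact .inr (hdy ▸ LeftOf.irrefl)
      · exact .inl (Finset.mem_erase.2 ⟨hdy, hd⟩)
    · have hz' : z ∈ U ∨ LeftOf β z y := by
        obtain hz | hz := hz
        · exact .inl (Finset.mem_of_mem_erase hz)
        · obtain rfl | hz := (leftOf_cons.1 hz).2
          · exact .inl hAU
          · exact .inr hz
      obtain ⟨d, hzd, hd, hd'⟩ := hI.greedy y z hy hz' hyz
      refine ⟨d, hzd, hd, ?_⟩
      by_cases hdA : d = A
      · subst hdA
        exact .inr fun h => (leftOf_cons.1 h).1 rfl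
      · refine hd'.imp (fun h => Finset.mem_erase.2 ⟨hdA, h⟩) fun h h' => ?_
        obtain h' | h' := (leftOf_cons.1 h').2
        · exact hne hy h'
        · exact h h'
  · intro B hB C hC hCs hBC
    obtain rfl : A = B := by simpa using hB
    by_contra hadj
    refine hmax C (Finset.mem_of_mem_erase hC) (fun b hb hCb => ?_) hBC
    by_cases hbA : b = A
    · exact hadj (hbA ▸ hCb)
    · exact hCs b (Finset.mem_erase.2 ⟨hbA, hb⟩) hCb

theorem CBInvariant.reaches_line10 {G : Digraph V} (hG : IsDAG G) {α β : List V}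
    (hα : IsNodeOrdering α) {U : Finset V} (hI : CBInvariant G α β U) (hU : U.Nonempty) :
    ∃ A ∈ U, CBInvariant G α (A :: β) (U.erase A) ∧
      Reaches (cbStep G α) (.line3 β U) (.line10 (A :: β) (U.erase A)) := by
  obtain ⟨A, hA⟩ := exists_rightmostSink hG hα hU
  obtain ⟨⟨hAU, hsink⟩, -⟩ := rightmostSink_eq_some hα hA
  refine ⟨A, hAU, hI.cons hG hα hA, ReflTransGen.head (b := .line5 (A :: β) U A) ?_ (.single ?_)⟩
  · simp [cbStep, hA]
  · cases β with
    | nil => simp [cbStep, rightNeighbor]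
    | cons B β =>
      -- The interchange test always fails, so each round merely prepends `A`.
      have := hI.head B rfl A hAU hsink
      have : ¬ (¬ G.Adj A B ∧ LeftOf α B A) := fun h => h.1 (this h.2)
      simp only [cbStep, rightNeighbor, if_true, if_neg this, Option.mem_def]

theorem CBInvariant.reaches_line11 {G : Digraph V} (hG : IsDAG G) {α : List V}
    (hα : IsNodeOrdering α) (U : Finset V) :
    ∀ β, CBInvariant G α β U → ∃ β', CBInvariant G α β' ∅ ∧
      Reaches (cbStep G α) (.line10 β U) (.line11 β') := by
  induction U using Finset.strongInduction with
  | H U ih =>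
    intro β hI
    obtain rfl | hU := U.eq_empty_or_nonempty
    · exact ⟨β, hI, .single (by simp [cbStep])⟩
    · obtain ⟨A, hA, hI', hr⟩ := hI.reaches_line10 hG hα hU
      obtain ⟨β', hβ', hr'⟩ := ih _ (Finset.erase_ssubset hA) _ hI'
      exact ⟨β', hβ', .head (b := .line3 β U) (by simp [cbStep, hU]) (hr.trans hr')⟩

theorem exists_constructBeta_eq [Fintype V] {G : Digraph V} (hG : IsDAG G) {α : List V}
    (hα : IsNodeOrdering α) :
    ∃ β, constructBeta G α = Part.some β ∧ IsNodeOrdering β ∧ Consistent G β ∧ IsGreedy G α β := by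
  have hI : CBInvariant G α [] Finset.univ := by constructor <;> simp
  have key : ∃ β, CBInvariant G α β ∅ ∧
      Reaches (cbStep G α) (.line3 [] Finset.univ) (.line11 β) := by
    by_cases hU : (Finset.univ : Finset V).Nonempty
    · obtain ⟨A, hA, hI', hr⟩ := hI.reaches_line10 hG hα hU
      obtain ⟨β, hβ, hr'⟩ := hI'.reaches_line11 hG hα
      exact ⟨β, hβ, hr.trans hr'⟩
    · obtain ⟨β, hβ, hr⟩ := hI.reaches_line11 hG hα
      refine ⟨β, hβ, .head ?_ hr⟩
      have : rightmostSink G α Finset.univ = none := by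
        rw [rightmostSink, List.find?_eq_none]
        intro x
        exact absurd ⟨x, Finset.mem_univ x⟩ hU
      simp [cbStep, this]
  obtain ⟨β, hβ, hr⟩ := key
  have hmem : ∀ v, v ∈ β := fun v => (hβ.mem v).2 (by simp)
  refine ⟨β, ?_, ⟨hβ.nodup, hmem⟩, fun a b hab => (hβ.consistent a b (hmem a) hab).2,
    fun y z hzy hyz => ?_⟩
  · rw [Part.eq_some_iff, constructBeta, Part.mem_map_iff]
    exact ⟨_, StateTransition.mem_eval.2 ⟨hr, by simp [cbStep]⟩, rfl⟩
  · simpa using hβ.greedy y z (hmem y) (.inr hzy) hyz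

end Orderings

/-! ### Methods A and B -/

theorem isChain_of_forall_eq_append {R : V → V → Prop} {l : List V}
    (h : ∀ l₁ u v l₂, l = l₁ ++ u :: v :: l₂ → R u v) : l.IsChain R := by
  induction l with
  | nil => simp
  | cons a l ih =>
    cases l with
    | nil => simp
    | cons b l =>
      rw [List.isChain_cons_cons]
      exact ⟨h [] a b l rfl, ih fun l₁ u v l₂ hl => h (a :: l₁) u v l₂ (by rw [hl]; rfl)⟩

theorem notMem_of_nodup_append {l r : List V} {y : V} (h : (l ++ y :: r).Nodup) :
    y ∉ l ∧ y ∉ r := by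
  rw [List.nodup_append] at h
  exact ⟨fun hy => h.2.2 y hy y (by simp) rfl, (List.nodup_cons.1 h.2.1).1⟩

section Orderings

variable [DecidableEq V]

theorem rightNeighbor_append {l r : List V} {y : V} (h : y ∉ l) :
    rightNeighbor (l ++ y :: r) y = r.head? := by
  induction l with
  | nil => cases r <;> simp [rightNeighbor]
  | cons a l ih =>
    rw [List.mem_cons, not_or] at h
    cases l with
    | nil => simpa [rightNeighbor, Ne.symm h.1] using ih h.2
    | cons b l => simpa [rightNeighbor, Ne.symm h.1] using ih h.2

theorem leftNeighbor_eq_none {l : List V} {y a : V} (h : y ∉ l) :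
    leftNeighbor (a :: l) y = none := by
  induction l generalizing a with
  | nil => simp [leftNeighbor]
  | cons b l ih =>
    rw [List.mem_cons, not_or] at h
    simpa [leftNeighbor, Ne.symm h.1] using ih h.2

theorem leftNeighbor_append {l r : List V} {y : V} (h : y ∉ l) (h' : y ∉ r) :
    leftNeighbor (l ++ y :: r) y = l.getLast? := by
  induction l with
  | nil => simpa using leftNeighbor_eq_none h'
  | cons a l ih =>
    rw [List.mem_cons, not_or] at h
    cases l with
    | nil => simp [leftNeighbor]
    | cons b l =>
      have hb : b ≠ y := by
        rintro rfl
        simp at h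
      simpa [leftNeighbor, hb] using ih h.2

theorem interchange_comm (y z : V) (β : List V) : interchange y z β = interchange z y β := by
  rw [interchange, Equiv.swap_comm, interchange]

theorem interchange_append {l r : List V} {y z : V} (h : (l ++ z :: y :: r).Nodup) :
    interchange y z (l ++ z :: y :: r) = l ++ y :: z :: r := by
  have hz := notMem_of_nodup_append h
  have hy := notMem_of_nodup_append (l := l ++ [z]) (by simpa using h)
  have key : ∀ {s : List V}, y ∉ s → z ∉ s → s.map (Equiv.swap y z) = s := by
    intro s hy hz
    refine (List.map_congr_left fun a ha => ?_).trans (List.map_id s)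
    exact Equiv.swap_apply_of_ne_of_ne (by rintro rfl; exact hy ha) (by rintro rfl; exact hz ha)
  simp only [List.mem_append, List.mem_cons, not_or, List.not_mem_nil] at hz hy
  simp [interchange, key hy.1.1 hz.1, key hy.2 hz.2.2]

theorem idxOf_append_cons {l r : List V} {y : V} (h : y ∉ l) :
    (l ++ y :: r).idxOf y = l.length := by
  simp [List.idxOf_append_of_notMem h]

theorem idxOf_adjacent {l r : List V} {y z : V} (h : (l ++ z :: y :: r).Nodup) :
    (l ++ z :: y :: r).idxOf y = (l ++ z :: y :: r).idxOf z + 1 := by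
  have hz := notMem_of_nodup_append h
  have hy := notMem_of_nodup_append (l := l ++ [z]) (r := r) (y := y) (by simpa using h)
  have := idxOf_append_cons (r := r) hy.1
  rw [idxOf_append_cons hz.1]
  simpa using this

theorem mem_of_leftOf_append {l r : List V} {y p : V} (h : y ∉ l) (hp : LeftOf (l ++ y :: r) p y) :
    p ∈ l := by
  by_contra hpl
  unfold LeftOf at hp
  rw [idxOf_append_cons h, List.idxOf_append_of_notMem hpl] at hp
  omega

theorem IsNodeOrdering.pairwise {α : List V} (hα : IsNodeOrdering α) : α.Pairwise (LeftOf α) := by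
  rw [List.pairwise_iff_getElem]
  intro i j hi hj hij
  rw [LeftOf, hα.1.idxOf_getElem, hα.1.idxOf_getElem]
  exact hij

theorem IsNodeOrdering.not_leftOf {α : List V} (hα : IsNodeOrdering α) {u v : V} (huv : u ≠ v)
    (h : ¬ LeftOf α v u) : LeftOf α u v :=
  (hα.total huv).resolve_right h

/-- A list whose consecutive nodes are not in the reverse order in `α` is sorted by `α`. -/
theorem IsNodeOrdering.pairwise_of_forall {α : List V} (hα : IsNodeOrdering α) {l : List V}
    (hl : l.Nodup) (h : ∀ l₁ u v l₂, l = l₁ ++ u :: v :: l₂ → ¬ LeftOf α v u) :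
    l.Pairwise (LeftOf α) := by
  have : IsTrans V (LeftOf α) := ⟨fun _ _ _ h h' => h.trans h'⟩
  refine (isChain_of_forall_eq_append fun l₁ u v l₂ hl' => ?_).pairwise
  refine hα.not_leftOf ?_ (h l₁ u v l₂ hl')
  rintro rfl
  subst hl'
  exact (notMem_of_nodup_append hl).2 (by simp)

theorem IsNodeOrdering.eq_of_pairwise {α β : List V} (hα : IsNodeOrdering α)
    (hβ : IsNodeOrdering β) (h : β.Pairwise (LeftOf α)) : β = α := by
  refine List.Perm.eq_of_pairwise (fun a b _ _ h h' => absurd h' h.asymm) h hα.pairwise ?_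
  rw [List.perm_ext_iff_of_nodup hβ.1 hα.1]
  exact fun v => iff_of_true (hβ.2 v) (hα.2 v)

/-- The number of pairs of nodes that are in a different order in `α` and `β`. -/
def inversions [Fintype V] (α β : List V) : ℕ :=
  (Finset.univ.filter fun p : V × V => LeftOf β p.1 p.2 ∧ LeftOf α p.2 p.1).card

theorem inversions_interchange_lt [Fintype V] {α β : List V} (hβ : IsNodeOrdering β) {y z : V}
    (hadj : β.idxOf y = β.idxOf z + 1) (hyz : LeftOf α y z) :
    inversions α (interchange y z β) < inversions α β := by
  refine Finset.card_lt_card ((Finset.ssubset_iff_of_subset ?_).2 ⟨(z, y), ?_, ?_⟩)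
  · rintro ⟨u, v⟩ h
    simp only [Finset.mem_filter, Finset.mem_univ, true_and, leftOf_interchange hβ hadj] at h ⊢
    obtain ⟨⟨h, -⟩ | ⟨rfl, rfl⟩, h'⟩ := h
    · exact ⟨h, h'⟩
    · exact absurd h' hyz.asymm
  · simp only [Finset.mem_filter, Finset.mem_univ, true_and]
    refine ⟨?_, hyz⟩
    unfold LeftOf
    omega
  · rw [Finset.mem_filter, leftOf_interchange hβ hadj]
    rintro ⟨-, ⟨-, h⟩ | ⟨h, -⟩, -⟩
    · exact h ⟨rfl, rfl⟩
    · exact hyz.ne h.symm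

/-- The data common to the runs of Methods A and B: an ordering `β₀` obtained from Construct `β`. -/
structure Start (G : Digraph V) (α β₀ : List V) : Prop where
  target : IsNodeOrdering α
  ordering : IsNodeOrdering β₀
  consistent : Consistent G β₀
  greedy : IsGreedy G α β₀

theorem Invariant.step_append [Fintype V] {G : Digraph V} {α β₀ : List V} (hS : Start G α β₀)
    {H : Digraph V} {l r : List V} {y z : V} (hI : Invariant G α β₀ H (l ++ z :: y :: r))
    (hyz : LeftOf α y z) (hmax : ∀ p ∈ l, LeftOf α p z) :
    Invariant G α β₀ (coverReverse H z y) (l ++ y :: z :: r) ∧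
      inversions α (l ++ y :: z :: r) < inversions α (l ++ z :: y :: r) := by
  have hnd := hI.ordering.1
  have hadj := idxOf_adjacent hnd
  rw [← interchange_append hnd]
  exact ⟨hI.step hS.consistent hS.target hS.ordering hS.greedy hadj hyz fun p hp =>
    hmax p (mem_of_leftOf_append (notMem_of_nodup_append hnd).1 hp),
    inversions_interchange_lt hI.ordering hadj hyz⟩

/-- As `l` is sorted, each node passed by `y` is right in `α` of all that precede it, as
`Invariant.step` demands. The strict decrease holds because the chosen `y` makes at least one
interchange. -/
theorem reaches_line8_of_line3_A [Fintype V] {G : Digraph V} {α β₀ : List V}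
    (hS : Start G α β₀) {y : V} (l : List V) : ∀ (H : Digraph V) (r : List V),
    Invariant G α β₀ H (l ++ y :: r) → l.Pairwise (LeftOf α) →
    ∃ H' β', Invariant G α β₀ H' β' ∧
      Reaches (stepA α) (.line3 H (l ++ y :: r) y) (.line8 H' β') ∧
      inversions α β' ≤ inversions α (l ++ y :: r) ∧
      ∀ z, l.getLast? = some z → LeftOf α y z →
        inversions α β' < inversions α (l ++ y :: r) := by
  induction l using List.reverseRecOn with
  | nil =>
    intro H r hI _
    have := leftNeighbor_eq_none (a := y) (notMem_of_nodup_append hI.ordering.1).2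
    exact ⟨H, _, hI, .single (by simp [stepA, this]), le_rfl, by simp⟩
  | append_singleton l z ih =>
    intro H r hI hl
    have hy := notMem_of_nodup_append hI.ordering.1
    have hn := leftNeighbor_append hy.1 hy.2
    rw [List.getLast?_concat] at hn
    by_cases hyz : LeftOf α y z
    · rw [List.pairwise_append] at hl
      have heq : l ++ [z] ++ y :: r = l ++ z :: y :: r := by simp
      rw [heq] at hI hn ⊢
      obtain ⟨hI', hlt⟩ := hI.step_append hS hyz fun p hp => hl.2.2 p hp z (by simp)
      obtain ⟨H', β', h1, h2, h3, -⟩ := ih _ _ hI' hl.1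
      refine ⟨H', β', h1, .head ?_ h2, (h3.trans_lt hlt).le, fun _ _ _ => h3.trans_lt hlt⟩
      simp only [stepA, hn, if_pos hyz, interchange_append hI.ordering.1, Option.mem_def]
    · refine ⟨H, _, hI, .single ?_, le_rfl, fun z' hz' h => ?_⟩
      · simp only [stepA, hn, if_neg hyz, Option.mem_def]
      · obtain rfl : z = z' := by simpa using hz'
        exact absurd h hyz

/-- Here `y` moves right, in the role of `z` in `Invariant.step`. The nodes before it are left of it
in `α`, and so is each node it passes. -/
theorem reaches_line8_of_line3_B [Fintype V] {G : Digraph V} {α β₀ : List V}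
    (hS : Start G α β₀) {y : V} (r : List V) : ∀ (H : Digraph V) (l : List V),
    Invariant G α β₀ H (l ++ y :: r) → (∀ p ∈ l, LeftOf α p y) →
    ∃ H' β', Invariant G α β₀ H' β' ∧
      Reaches (stepB α) (.line3 H (l ++ y :: r) y) (.line8 H' β') ∧
      inversions α β' ≤ inversions α (l ++ y :: r) ∧
      ∀ z, r.head? = some z → LeftOf α z y →
        inversions α β' < inversions α (l ++ y :: r) := by
  induction r with
  | nil =>
    intro H l hI _
    have := rightNeighbor_append (r := []) (notMem_of_nodup_append hI.ordering.1).1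
    exact ⟨H, _, hI, .single (by simp [stepB, this]), le_rfl, by simp⟩
  | cons z r ih =>
    intro H l hI hl
    have hn := rightNeighbor_append (r := z :: r) (notMem_of_nodup_append hI.ordering.1).1
    rw [List.head?_cons] at hn
    by_cases hzy : LeftOf α z y
    · obtain ⟨hI', hlt⟩ := hI.step_append hS hzy hl
      have heq : l ++ z :: y :: r = l ++ [z] ++ y :: r := by simp
      have hint := interchange_append hI.ordering.1
      rw [heq] at hI' hlt hint
      obtain ⟨H', β', h1, h2, h3, -⟩ := ih _ _ hI' (by simpa [or_imp, forall_and, hzy] using hl)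
      refine ⟨H', β', h1, .head ?_ h2, (h3.trans_lt hlt).le, fun _ _ _ => h3.trans_lt hlt⟩
      simp only [stepB, hn, if_pos hzy, interchange_comm y z, hint, Option.mem_def]
    · refine ⟨H, _, hI, .single ?_, le_rfl, fun z' hz' h => ?_⟩
      · simp only [stepB, hn, if_neg hzy, Option.mem_def]
      · obtain rfl : z = z' := by simpa using hz'
        exact absurd h hzy

theorem reaches_line8_of_line2_A [Fintype V] {G : Digraph V} {α β₀ : List V}
    (hS : Start G α β₀) {H : Digraph V} {β : List V} (hI : Invariant G α β₀ H β) :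
    (β = α ∧ Reaches (stepA α) (.line2 H β) (.line8 H β)) ∨
      ∃ H' β', Invariant G α β₀ H' β' ∧ Reaches (stepA α) (.line2 H β) (.line8 H' β') ∧
        inversions α β' < inversions α β := by
  have hnd := hI.ordering.1
  have hn : ∀ {l₁ u v l₂}, β = l₁ ++ u :: v :: l₂ → leftNeighbor β v = some u := by
    rintro l₁ u v l₂ rfl
    have heq : l₁ ++ u :: v :: l₂ = l₁ ++ [u] ++ v :: l₂ := by simp
    rw [heq] at hnd ⊢
    have hv := notMem_of_nodup_append hnd
    rw [leftNeighbor_append hv.1 hv.2, List.getLast?_concat]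
  rcases hf : β.find? fun Y => (leftNeighbor β Y).any fun Z => decide (LeftOf α Y Z) with _ | y
  · refine .inl ⟨hS.target.eq_of_pairwise hI.ordering
      (hS.target.pairwise_of_forall hnd fun l₁ u v l₂ hβ => ?_), .single ?_⟩
    · rw [List.find?_eq_none] at hf
      simpa [hn hβ] using hf v (by simp [hβ])
    · simp only [stepA, hf, Option.mem_def]
  · right
    obtain ⟨h1, l, r, hβ, h3⟩ := List.find?_eq_some_iff_append.1 hf
    have hstep : stepA α (.line2 H β) = some (.line3 H β y) := by simp only [stepA, hf]
    have hy := notMem_of_nodup_append (hβ ▸ hnd)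
    have hl : l.Pairwise (LeftOf α) := by
      refine hS.target.pairwise_of_forall ?_ fun l₁ u v l₂ hl => ?_
      · rw [hβ, List.nodup_append] at hnd
        exact hnd.1
      · have := h3 v (by simp [hl])
        rw [hn (l₁ := l₁) (u := u) (v := v) (l₂ := l₂ ++ y :: r) (by rw [hβ, hl]; simp)] at this
        simpa using this
    have hly : leftNeighbor β y = l.getLast? := by rw [hβ, leftNeighbor_append hy.1 hy.2]
    obtain ⟨z, hz, hyz⟩ : ∃ z, l.getLast? = some z ∧ LeftOf α y z := by
      rw [hly, Option.any_eq_true] at h1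
      simpa using h1
    obtain ⟨H', β', h4, h5, -, h6⟩ := reaches_line8_of_line3_A hS l H r (hβ ▸ hI) hl
    rw [← hβ] at h5 h6
    exact ⟨H', β', h4, .head hstep h5, h6 z hz hyz⟩

theorem reaches_line8_of_line2_B [Fintype V] {G : Digraph V} {α β₀ : List V}
    (hS : Start G α β₀) {H : Digraph V} {β : List V} (hI : Invariant G α β₀ H β) :
    (β = α ∧ Reaches (stepB α) (.line2 H β) (.line8 H β)) ∨
      ∃ H' β', Invariant G α β₀ H' β' ∧ Reaches (stepB α) (.line2 H β) (.line8 H' β') ∧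
        inversions α β' < inversions α β := by
  have hnd := hI.ordering.1
  have hn : ∀ {l₁ u v l₂}, β = l₁ ++ u :: v :: l₂ → rightNeighbor β u = some v := by
    rintro l₁ u v l₂ rfl
    simp [rightNeighbor_append (notMem_of_nodup_append hnd).1]
  rcases hf : β.find? fun Y => (rightNeighbor β Y).any fun Z => decide (LeftOf α Z Y) with _ | y
  · refine .inl ⟨hS.target.eq_of_pairwise hI.ordering
      (hS.target.pairwise_of_forall hnd fun l₁ u v l₂ hβ => ?_), .single ?_⟩
    · rw [List.find?_eq_none] at hf
      simpa [hn hβ] using hf u (by simp [hβ])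
    · simp only [stepB, hf, Option.mem_def]
  · right
    obtain ⟨h1, l, r, hβ, h3⟩ := List.find?_eq_some_iff_append.1 hf
    have hstep : stepB α (.line2 H β) = some (.line3 H β y) := by simp only [stepB, hf]
    have hy := notMem_of_nodup_append (hβ ▸ hnd)
    have hβ' : β = l ++ [y] ++ r := by simp [hβ]
    have hl : (l ++ [y]).Pairwise (LeftOf α) := by
      refine hS.target.pairwise_of_forall ?_ fun l₁ u v l₂ hl => ?_
      · rw [hβ', List.nodup_append] at hnd
        exact hnd.1
      · have hu : u ∈ l := by
          obtain ⟨h, -⟩ | ⟨_, -, h⟩ := append_singleton_eq_append_cons hl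
          · simp at h
          · simp [h]
        have := h3 u hu
        rw [hn (l₁ := l₁) (u := u) (v := v) (l₂ := l₂ ++ r) (by rw [hβ', hl]; simp)] at this
        simpa using this
    have hry : rightNeighbor β y = r.head? := by rw [hβ, rightNeighbor_append hy.1]
    obtain ⟨z, hz, hyz⟩ : ∃ z, r.head? = some z ∧ LeftOf α z y := by
      rw [hry, Option.any_eq_true] at h1
      simpa using h1
    obtain ⟨H', β', h4, h5, -, h6⟩ := reaches_line8_of_line3_B hS r H l (hβ ▸ hI) fun p hp =>
      (List.pairwise_append.1 hl).2.2 p hp y (by simp)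
    rw [← hβ] at h5 h6
    exact ⟨H', β', h4, .head hstep h5, h6 z hz hyz⟩

/-- The outer loop is common to both methods. Its test follows its body, so a pass can begin with `β
= α`; any other pass lowers the number of inversions. -/
theorem reaches_line9 [Fintype V] {G : Digraph V} {α β₀ : List V}
    {step : MState V → Option (MState V)}
    (h8 : ∀ H β, step (.line8 H β) = if β ≠ α then some (.line2 H β) else some (.line9 H))
    (h2 : ∀ H β, Invariant G α β₀ H β → (β = α ∧ Reaches step (.line2 H β) (.line8 H β)) ∨
      ∃ H' β', Invariant G α β₀ H' β' ∧ Reaches step (.line2 H β) (.line8 H' β') ∧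
        inversions α β' < inversions α β)
    {H : Digraph V} {β : List V} (hI : Invariant G α β₀ H β) :
    ∃ H', Invariant G α β₀ H' α ∧ Reaches step (.line2 H β) (.line9 H') := by
  induction hn : inversions α β using Nat.strong_induction_on generalizing H β with
  | _ n ih =>
    obtain ⟨rfl, hr⟩ | ⟨H', β', hI', hr, hlt⟩ := h2 H β hI
    · exact ⟨H, hI, hr.tail (by simp [h8])⟩
    · by_cases hβ : β' = α
      · subst hβ
        exact ⟨H', hI', hr.tail (by simp [h8])⟩
      · obtain ⟨H'', hI'', hr'⟩ := ih _ (hn ▸ hlt) hI' rfl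
        refine ⟨H'', hI'', hr.trans (.head ?_ hr')⟩
        simp [h8, hβ]

theorem exists_methodA_eq [Fintype V] {G : Digraph V} (hG : IsDAG G) {α : List V}
    (hα : IsNodeOrdering α) : ∃ H β₀, Invariant G α β₀ H α ∧ methodA G α = Part.some H := by
  obtain ⟨β, h1, h2, h3, h4⟩ := exists_constructBeta_eq hG hα
  obtain ⟨H, hI, hr⟩ := reaches_line9 (step := stepA α) (fun _ _ => rfl)
    (fun _ _ hI => reaches_line8_of_line2_A ⟨hα, h2, h3, h4⟩ hI) (Invariant.init h2 h3)
  refine ⟨H, β, hI, ?_⟩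
  rw [methodA, h1, Part.bind_some, Part.eq_some_iff, Part.mem_map_iff]
  exact ⟨_, StateTransition.mem_eval.2 ⟨hr, rfl⟩, rfl⟩

theorem exists_methodB_eq [Fintype V] {G : Digraph V} (hG : IsDAG G) {α : List V}
    (hα : IsNodeOrdering α) : ∃ H β₀, Invariant G α β₀ H α ∧ methodB G α = Part.some H := by
  obtain ⟨β, h1, h2, h3, h4⟩ := exists_constructBeta_eq hG hα
  obtain ⟨H, hI, hr⟩ := reaches_line9 (step := stepB α) (fun _ _ => rfl)
    (fun _ _ hI => reaches_line8_of_line2_B ⟨hα, h2, h3, h4⟩ hI) (Invariant.init h2 h3)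
  refine ⟨H, β, hI, ?_⟩
  rw [methodB, h1, Part.bind_some, Part.eq_some_iff, Part.mem_map_iff]
  exact ⟨_, StateTransition.mem_eval.2 ⟨hr, rfl⟩, rfl⟩

end Orderings

end ConsensusBN

theorem mainTheorem1 {V : Type*} [Fintype V] [DecidableEq V] (G : Digraph V)
    (hG : ConsensusBN.IsDAG G) (α : List V) (hα : ConsensusBN.IsNodeOrdering α) :
    (∃! H : Digraph V, ConsensusBN.IsMDIMapRel (ConsensusBN.inducedModel G) α H) ∧
      ∀ Gα : Digraph V, ConsensusBN.IsMDIMapRel (ConsensusBN.inducedModel G) α Gα →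
        ConsensusBN.methodA G α = Part.some Gα ∧ ConsensusBN.methodB G α = Part.some Gα := by
  obtain ⟨H, β, hI, hA⟩ := ConsensusBN.exists_methodA_eq hG hα
  obtain ⟨H', β', hI', hB⟩ := ConsensusBN.exists_methodB_eq hG hα
  refine ⟨⟨H, hI.isMDIMapRel, fun K hK => hI.eq_of_isMDIMapRel hK⟩, fun K hK => ⟨?_, ?_⟩⟩
  · rw [hA, hI.eq_of_isMDIMapRel hK]
  · rw [hB, hI'.eq_of_isMDIMapRel hK]
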